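/- Let $R$ be a domain and let $q_1,q_2\in R$ be units such that $q_1+q_2$ is also a unit. For $n\ge 1$ let $B_n$ be the braid group with generators $\sigma_1,\dots,\sigma_{n-1}$ and relations $\sigma_i\sigma_j=\sigma_j\sigma_i$ for $|i-j|>1$ and $\sigma_i\sigma_j\sigma_i=\sigma_j\sigma_i\sigma_j$ for $|i-j|=1$. Let $\mathcal H_n=\mathcal H_n(q_1,q_2)$ be the associative $R$-algebra with generators $T_1,\dots,T_{n-1}$ and relations $T_iT_j=T_jT_i$ for $|i-j|>1$, $T_iT_jT_i=T_jT_iT_j$ for $|i-j|=1$, and $(T_i-q_1)(T_i-q_2)=0$. Each $T_i$ is invertible, so $\sigma_i\mapsto T_i$ defines a homomorphism $B_n\to\mathcal H_n^\times$. Denote by $\iota$ both $B_n\to B_{n+1}$, $\sigma_i\mapsto\sigma_i$, and $\mathcal H_n\to\mathcal H_{n+1}$, $T_i\mapsto T_i$. For a partition $\lambda=(\lambda_1\ge\dots\ge\lambda_k>0)$ of $n$ let $b_\lambda\in B_n$ be the disjoint union, from left to right, of the braids $b_{(\lambda_1)},\dots,b_{(\lambda_k)}$, where $b_{(m)}=\sigma_{m-1}\cdots\sigma_2\sigma_1\in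 B_m$; we also write $b_\lambda$ for its image in $\mathcal H_n$. A trace function on $\mathcal H_n$ is an $R$-linear map $t:\mathcal H_n\to R$ with $t(ab)=t(ba)$ for all $a,b$. A normalized Markov trace is a family of $R$-linear maps $\operatorname{tr}:\mathcal H_n\to R$ ($n\ge1$) such that, for all $n\ge 1$ and $a,b\in\mathcal H_n$, $$\operatorname{tr}(ab)=\operatorname{tr}(ba),\qquad \operatorname{tr}(b)=\operatorname{tr}(T_n\,\iota(b)),\qquad \operatorname{tr}(b)=\operatorname{tr}(T_n^{-1}\iota(b)).$$ Then there is a normalized Markov trace $\operatorname{tr}$ with the following properties. 1. $\operatorname{tr}(\mathrm{id}_1)=1$, where $\mathrm{id}_1$ is the identity of $\mathcal H_1$. 2. For every $n\ge1$ and every partition $\lambda$ of $n$ with $k$ parts, $$\operatorname{tr}(b_\lambda)=\left(\frac{1+q_1q_2}{q_1+q_2}\right)^{k-1},$$ and $\operatorname{tr}:\mathcal H_n\to R$ is the only trace function on $\mathcal H_n$ that takes these values at the $b_\lambda$. 3. Every normalized Markov trace is a scalar multiple $c\cdot\operatorname{tr}$, with $c\in R$ independent of $n$. 4. The map $b\mapsto\operatorname{tr}(b)$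 on $B_\infty=\bigsqcup_{n\ge1}B_n$ defines an $R$-valued link invariant $P$, the HOMFLYPT polynomial. Here a link is regarded as a class of braids in $B_\infty$ modulo the equivalence relation generated by the Markov moves $ab\leftrightarrow ba$, $b\leftrightarrow\sigma_n\iota(b)$, $b\leftrightarrow\sigma_n^{-1}\iota(b)$ ($n\ge 1$, $a,b\in B_n$); by the classical theorems of Alexander and Markov these classes correspond to isotopy classes of oriented links in $S^3$, the class $\hat b$ of $b$ corresponding to the closure of $b$. That is, there is a well-defined function $P$ on these classes with $P(\hat b)=\operatorname{tr}(b)$ for every $b\in B_\infty$. It satisfies $P=1$ on the unknot (the class of $1\in B_1$) and the skein relation $$P(\widehat{a\sigma_ib})+q_1q_2\,P(\widehat{a\sigma_i^{-1}b})=(q_1+q_2)\,P(\widehat{ab})$$ for all $n\ge1$, $a,b\in B_n$ and $1\le i<n$. -/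

import Mathlib

noncomputable section

namespace BraidTrace

/-- The index set `{1, …, n - 1}` of the generators on `n` strands. -/
abbrev GenIdx (n : ℕ) : Type := {i : ℕ // 1 ≤ i ∧ i < n}

/-- The inclusion `{1, …, n - 1} ⊆ {1, …, n}`. -/
def GenIdx.incl {n : ℕ} (i : GenIdx n) : GenIdx (n + 1) :=
  ⟨i.1, i.2.1, Nat.lt_succ_of_lt i.2.2⟩

/-- The last index `n` on `n + 1` strands (for `n ≥ 1`, written here as `n + 1` on `n + 2`). -/
def GenIdx.last (n : ℕ) : GenIdx (n + 2) :=
  ⟨n + 1, Nat.succ_le_succ (Nat.zero_le n), Nat.lt_succ_self (n + 1)⟩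

/-! ### Braid groups -/

/-- The defining relators of the braid group:
`σᵢσⱼ = σⱼσᵢ` for `|i - j| > 1` and `σᵢσⱼσᵢ = σⱼσᵢσⱼ` for `|i - j| = 1`. -/
inductive BraidRel (n : ℕ) : FreeGroup (GenIdx n) → Prop
  | comm (i j : GenIdx n) (h : i.1 + 1 < j.1 ∨ j.1 + 1 < i.1) :
      BraidRel n (FreeGroup.of i * FreeGroup.of j * (FreeGroup.of j * FreeGroup.of i)⁻¹)
  | braid (i j : GenIdx n) (h : i.1 + 1 = j.1 ∨ j.1 + 1 = i.1) :
      BraidRel n (FreeGroup.of i * FreeGroup.of j * FreeGroup.of i *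
        (FreeGroup.of j * FreeGroup.of i * FreeGroup.of j)⁻¹)

/-- The braid group `B_n` on `n` strands. -/
abbrev Braid (n : ℕ) : Type := PresentedGroup {r | BraidRel n r}

/-- The generator `σᵢ` of `B_n`, for `1 ≤ i < n`. -/
def sigma {n : ℕ} (i : GenIdx n) : Braid n := PresentedGroup.of i

theorem sigma_comm {n : ℕ} (i j : GenIdx n) (h : i.1 + 1 < j.1 ∨ j.1 + 1 < i.1) :
    sigma i * sigma j = sigma j * sigma i := by
  have := PresentedGroup.one_of_mem (rels := {r | BraidRel n r}) (BraidRel.comm i j h)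
  rw [map_mul, map_inv, mul_inv_eq_one, map_mul, map_mul] at this
  exact this

theorem sigma_braid {n : ℕ} (i j : GenIdx n) (h : i.1 + 1 = j.1 ∨ j.1 + 1 = i.1) :
    sigma i * sigma j * sigma i = sigma j * sigma i * sigma j := by
  have := PresentedGroup.one_of_mem (rels := {r | BraidRel n r}) (BraidRel.braid i j h)
  rw [map_mul, map_inv, mul_inv_eq_one, map_mul, map_mul, map_mul, map_mul] at this
  exact this

theorem relators_map {n : ℕ} {G : Type*} [Group G] (f : GenIdx n → G)
    (hc : ∀ i j : GenIdx n, (i.1 + 1 < j.1 ∨ j.1 + 1 < i.1) → f i * f j = f j * f i)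
    (hb : ∀ i j : GenIdx n, (i.1 + 1 = j.1 ∨ j.1 + 1 = i.1) →
      f i * f j * f i = f j * f i * f j) :
    ∀ r ∈ {r | BraidRel n r}, FreeGroup.lift f r = 1 := by
  intro r hr
  cases hr with
  | comm i j h =>
    rw [map_mul, map_inv, mul_inv_eq_one]
    simpa using hc i j h
  | braid i j h =>
    rw [map_mul, map_inv, mul_inv_eq_one]
    simpa using hb i j h

/-- The inclusion `ι : B_n → B_{n+1}`, `σᵢ ↦ σᵢ`, adding a straight strand on the right. -/
def braidIncl (n : ℕ) : Braid n →* Braid (n + 1) :=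
  PresentedGroup.toGroup (f := fun i : GenIdx n => sigma i.incl)
    (relators_map _ (fun i j h => sigma_comm i.incl j.incl h)
      (fun i j h => sigma_braid i.incl j.incl h))

/-! ### The Iwahori-Hecke algebra -/

section Hecke

variable {R : Type*} [CommRing R] (q₁ q₂ : Rˣ)

/-- The defining relations of the Iwahori-Hecke algebra. -/
inductive HeckeRel (n : ℕ) : FreeAlgebra R (GenIdx n) → FreeAlgebra R (GenIdx n) → Prop
  | comm (i j : GenIdx n) (h : i.1 + 1 < j.1 ∨ j.1 + 1 < i.1) :
      HeckeRel n (FreeAlgebra.ι R i * FreeAlgebra.ι R j) (FreeAlgebra.ι R j * FreeAlgebra.ι R i)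
  | braid (i j : GenIdx n) (h : i.1 + 1 = j.1 ∨ j.1 + 1 = i.1) :
      HeckeRel n (FreeAlgebra.ι R i * FreeAlgebra.ι R j * FreeAlgebra.ι R i)
        (FreeAlgebra.ι R j * FreeAlgebra.ι R i * FreeAlgebra.ι R j)
  | quad (i : GenIdx n) :
      HeckeRel n
        ((FreeAlgebra.ι R i - algebraMap R _ (q₁ : R)) *
          (FreeAlgebra.ι R i - algebraMap R _ (q₂ : R))) 0

/-- The Iwahori-Hecke algebra `H_n(q₁, q₂)`. -/
def Hecke (n : ℕ) : Type _ := RingQuot (HeckeRel q₁ q₂ n)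

instance (n : ℕ) : Ring (Hecke q₁ q₂ n) := inferInstanceAs (Ring (RingQuot (HeckeRel q₁ q₂ n)))

instance (n : ℕ) : Algebra R (Hecke q₁ q₂ n) :=
  inferInstanceAs (Algebra R (RingQuot (HeckeRel q₁ q₂ n)))

/-- The quotient map from the free algebra onto `H_n(q₁, q₂)`. -/
def heckeMk (n : ℕ) : FreeAlgebra R (GenIdx n) →ₐ[R] Hecke q₁ q₂ n :=
  RingQuot.mkAlgHom R (HeckeRel q₁ q₂ n)

/-- The generator `Tᵢ` of `H_n(q₁, q₂)`, for `1 ≤ i < n`. -/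
def gen {n : ℕ} (i : GenIdx n) : Hecke q₁ q₂ n := heckeMk q₁ q₂ n (FreeAlgebra.ι R i)

theorem heckeMk_rel {n : ℕ} {x y : FreeAlgebra R (GenIdx n)} (h : HeckeRel q₁ q₂ n x y) :
    heckeMk q₁ q₂ n x = heckeMk q₁ q₂ n y :=
  RingQuot.mkAlgHom_rel R h

theorem gen_comm {n : ℕ} (i j : GenIdx n) (h : i.1 + 1 < j.1 ∨ j.1 + 1 < i.1) :
    gen q₁ q₂ i * gen q₁ q₂ j = gen q₁ q₂ j * gen q₁ q₂ i := by
  simpa [gen] using heckeMk_rel q₁ q₂ (HeckeRel.comm i j h)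

theorem gen_braid {n : ℕ} (i j : GenIdx n) (h : i.1 + 1 = j.1 ∨ j.1 + 1 = i.1) :
    gen q₁ q₂ i * gen q₁ q₂ j * gen q₁ q₂ i = gen q₁ q₂ j * gen q₁ q₂ i * gen q₁ q₂ j := by
  simpa [gen] using heckeMk_rel q₁ q₂ (HeckeRel.braid i j h)

theorem gen_quad {n : ℕ} (i : GenIdx n) :
    (gen q₁ q₂ i - algebraMap R _ (q₁ : R)) * (gen q₁ q₂ i - algebraMap R _ (q₂ : R)) = 0 := by
  simpa [gen] using heckeMk_rel q₁ q₂ (HeckeRel.quad (q₁ := q₁) (q₂ := q₂) i)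

/-- The inclusion `ι : H_n → H_{n+1}`, `Tᵢ ↦ Tᵢ`. -/
def heckeIncl (n : ℕ) : Hecke q₁ q₂ n →ₐ[R] Hecke q₁ q₂ (n + 1) :=
  RingQuot.liftAlgHom R ⟨FreeAlgebra.lift R fun i : GenIdx n => gen q₁ q₂ i.incl, by
    intro x y h
    cases h with
    | comm i j h => simpa using gen_comm q₁ q₂ i.incl j.incl h
    | braid i j h => simpa using gen_braid q₁ q₂ i.incl j.incl h
    | quad i => simpa using gen_quad q₁ q₂ i.incl⟩

theorem gen_mul_aux {n : ℕ} (i : GenIdx n) :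
    gen q₁ q₂ i * (algebraMap R _ ((q₁ : R) + q₂) - gen q₁ q₂ i) =
      algebraMap R _ ((q₁ : R) * q₂) := by
  have h := gen_quad q₁ q₂ i
  have hc := Algebra.commutes (q₁ : R) (gen q₁ q₂ i)
  rw [sub_mul, mul_sub, mul_sub, hc] at h
  rw [map_add, map_mul, mul_sub, mul_add, ← sub_eq_zero, ← neg_eq_zero, ← h]
  abel

theorem gen_aux_mul {n : ℕ} (i : GenIdx n) :
    (algebraMap R _ ((q₁ : R) + q₂) - gen q₁ q₂ i) * gen q₁ q₂ i =
      algebraMap R _ ((q₁ : R) * q₂) := by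
  rw [← gen_mul_aux q₁ q₂ i, sub_mul, mul_sub, Algebra.commutes]

/-- The generator `Tᵢ` as a unit of `H_n(q₁, q₂)`, with inverse
`Tᵢ⁻¹ = (q₁ + q₂ - Tᵢ) / (q₁ q₂)`. -/
def genUnit {n : ℕ} (i : GenIdx n) : (Hecke q₁ q₂ n)ˣ where
  val := gen q₁ q₂ i
  inv := (((q₁ * q₂)⁻¹ : Rˣ) : R) • (algebraMap R _ ((q₁ : R) + q₂) - gen q₁ q₂ i)
  val_inv := by
    rw [mul_smul_comm, gen_mul_aux, Algebra.smul_def, ← map_mul, ← Units.val_mul,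
      ← Units.val_mul, inv_mul_cancel, Units.val_one, map_one]
  inv_val := by
    rw [smul_mul_assoc, gen_aux_mul, Algebra.smul_def, ← map_mul, ← Units.val_mul,
      ← Units.val_mul, inv_mul_cancel, Units.val_one, map_one]

/-- The homomorphism `B_n → H_n(q₁, q₂)ˣ`, `σᵢ ↦ Tᵢ`. -/
def braidToHecke (n : ℕ) : Braid n →* (Hecke q₁ q₂ n)ˣ :=
  PresentedGroup.toGroup (f := fun i : GenIdx n => genUnit q₁ q₂ i)
    (relators_map _ (fun i j h => Units.ext (gen_comm q₁ q₂ i j h))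
      (fun i j h => Units.ext (gen_braid q₁ q₂ i j h)))

end Hecke

/-! ### The braids `b_λ` -/

/-- The indices, in order, of the word for the disjoint union, from left to right, of the braids
`b_(m) = σ_{m-1} ⋯ σ₂ σ₁` for `m` in the given list, the first strand being strand `s + 1`:
the block of the first entry `m` is `s + m - 1, …, s + 2, s + 1`. -/
def blockWord : ℕ → List ℕ → List ℕ
  | _, [] => []
  | s, m :: l => (List.range' (s + 1) (m - 1)).reverse ++ blockWord (s + m) l

theorem mem_blockWord {i : ℕ} : ∀ (l : List ℕ) (s : ℕ), i ∈ blockWord s l →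
    s + 1 ≤ i ∧ i < s + l.sum
  | [], s, h => by simp [blockWord] at h
  | m :: l, s, h => by
    rw [blockWord, List.mem_append, List.mem_reverse, List.mem_range'_1] at h
    rw [List.sum_cons]
    rcases h with h | h
    · omega
    · have := mem_blockWord l (s + m) h
      omega

/-- The parts `λ₁ ≥ λ₂ ≥ ⋯ ≥ λ_k > 0` of a partition, in decreasing order. -/
def sortedParts {n : ℕ} (p : n.Partition) : List ℕ := p.parts.sort (· ≥ ·)

theorem sum_sortedParts {n : ℕ} (p : n.Partition) : (sortedParts p).sum = n := by
  rw [sortedParts, ← Multiset.sum_coe, Multiset.sort_eq, p.parts_sum]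

/-- The braid `b_λ` in `B_n`, for a partition `λ` of `n`. -/
def partitionBraid {n : ℕ} (p : n.Partition) : Braid n :=
  ((blockWord 0 (sortedParts p)).pmap (fun i hi => sigma (⟨i, hi⟩ : GenIdx n)) (by
    intro i hi
    have := mem_blockWord _ _ hi
    rw [sum_sortedParts] at this
    omega)).prod

/-! ### Traces and Markov moves -/

section Trace

variable {R : Type*} [CommRing R] {q₁ q₂ : Rˣ}

/-- A trace function on `H_n(q₁, q₂)`. -/
def IsTraceFunction {n : ℕ} (t : Hecke q₁ q₂ n →ₗ[R] R) : Prop :=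
  ∀ a b : Hecke q₁ q₂ n, t (a * b) = t (b * a)

/-- A normalized Markov trace: a family of linear maps on all the `H_n(q₁, q₂)` with `n ≥ 1`
(`tr n` being the map on `H_{n+1}`), invariant under the Markov moves. -/
structure IsNormalizedMarkovTrace (tr : ∀ n : ℕ, Hecke q₁ q₂ (n + 1) →ₗ[R] R) : Prop where
  trace : ∀ n, IsTraceFunction (tr n)
  stab : ∀ (n : ℕ) (b : Hecke q₁ q₂ (n + 1)),
    tr n b = tr (n + 1) (gen q₁ q₂ (GenIdx.last n) * heckeIncl q₁ q₂ (n + 1) b)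
  stab_inv : ∀ (n : ℕ) (b : Hecke q₁ q₂ (n + 1)),
    tr n b = tr (n + 1)
      (((genUnit q₁ q₂ (GenIdx.last n))⁻¹ : (Hecke q₁ q₂ (n + 2))ˣ) *
        heckeIncl q₁ q₂ (n + 1) b)

end Trace

/-- `B_∞`, the disjoint union of the braid groups `B_n` for `n ≥ 1`; the pair `⟨n, b⟩` stands for
`b ∈ B_{n+1}`. -/
abbrev BraidInf : Type := Σ n : ℕ, Braid (n + 1)

/-- The Markov moves. -/
inductive MarkovMove : BraidInf → BraidInf → Prop
  | conj (n : ℕ) (a b : Braid (n + 1)) : MarkovMove ⟨n, a * b⟩ ⟨n, b * a⟩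
  | stab (n : ℕ) (b : Braid (n + 1)) :
      MarkovMove ⟨n, b⟩ ⟨n + 1, sigma (GenIdx.last n) * braidIncl (n + 1) b⟩
  | stab_inv (n : ℕ) (b : Braid (n + 1)) :
      MarkovMove ⟨n, b⟩ ⟨n + 1, (sigma (GenIdx.last n))⁻¹ * braidIncl (n + 1) b⟩

/-- Braids up to the equivalence relation generated by the Markov moves. By the theorems of
Alexander and Markov this is the set of isotopy classes of oriented links, the class of a braid being its closure. -/
def BraidLink : Type := Quot MarkovMove

/-- The closure of a braid in `B_{n+1}`, as a link. -/
def closure {n : ℕ} (b : Braid (n + 1)) : BraidLink := Quot.mk MarkovMove ⟨n, b⟩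

end BraidTrace

end

/-! Existence rests on the tower of the `H_n`. Over `H_n`, the right module `H_{n+1}` is spanned by
the elements `T_{k+1} ⋯ T_n`, `0 ≤ k ≤ n`, and left multiplication by each `Tᵢ` has an explicit
matrix in them. These matrices satisfy the Hecke relations, so they define coordinates on `H_{n+1}`,
and from the coordinates one gets an `H_n`-bimodule map `E : H_{n+1} → H_n` with `E(T_n) = 1` and
`E(1) = z` (`condExp`). The trace is the composite of these maps down to `H_1 = R`. That it is a
trace comes from the identity `E(T x T) = (q₁ + q₂) x - q₁ q₂ E(x)` for the last generator `T`
(`condExp_heckeT_mul_mul`). Positive stabilization is `E(T) = 1`; negative stabilization is `E(T⁻¹)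
= 1`, which amounts to `(q₁ + q₂) z = 1 + q₁ q₂` and fixes `z`.

Uniqueness rests on `H_{n+1} = H_n + H_n T_n H_n`: modulo commutators every element reduces to a
combination of block braids indexed by compositions (`eq_zero_of_blockProd`). Exchanging adjacent
blocks is a conjugation (`IsBraidSeq.semiconjBy_swap`), so partitions suffice. Any normalized Markov
trace can be evaluated on `b_λ` by destabilizing, with result `z ^ (k - 1)` times its value at `1 ∈
H_1`; hence it is a multiple of the one constructed. The link invariant and its skein relation then
restate the Markov axioms and the quadratic relation. -/

noncomputable section

namespace BraidTrace

/-! ### Products of consecutive elements of a sequence -/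

section Sequences

variable {M : Type*} [Monoid M] (u : ℕ → M)

/-- The ascending product `u (k + 1) * u (k + 2) * ⋯ * u (k + d)`. -/
def ascProd : ℕ → ℕ → M
  | 0, _ => 1
  | d + 1, k => u (k + 1) * ascProd d (k + 1)

/-- The descending product `u (k + d) * ⋯ * u (k + 2) * u (k + 1)`. -/
def descProd : ℕ → ℕ → M
  | 0, _ => 1
  | d + 1, k => u (k + d + 1) * descProd d k

theorem ascProd_succ_last (d k : ℕ) : ascProd u (d + 1) k = ascProd u d k * u (k + d + 1) := by
  induction d generalizing k with
  | zero => simp [ascProd]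
  | succ d ih =>
    rw [ascProd, ih, ascProd, mul_assoc]
    congr 3
    omega

theorem list_prod_eq_descProd (d k : ℕ) :
    ((List.range' (k + 1) d).reverse.map u).prod = descProd u d k := by
  induction d with
  | zero => simp [descProd]
  | succ d ih =>
    rw [List.range'_concat, List.reverse_append, List.map_append, List.prod_append, ih, descProd]
    simp [add_right_comm]

theorem map_ascProd {M' F : Type*} [Monoid M'] [FunLike F M M'] [MonoidHomClass F M M'] (f : F)
    (u' : ℕ → M') (d k : ℕ) (h : ∀ i, k < i → i ≤ k + d → f (u i) = u' i) :
    f (ascProd u d k) = ascProd u' d k := by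
  induction d generalizing k with
  | zero => simp [ascProd]
  | succ d ih =>
    rw [ascProd, ascProd, map_mul, h _ (by omega) (by omega),
      ih (k + 1) fun i h₁ h₂ => h i (by omega) (by omega)]

theorem map_descProd {M' F : Type*} [Monoid M'] [FunLike F M M'] [MonoidHomClass F M M'] (f : F)
    (u' : ℕ → M') (d k : ℕ) (h : ∀ i, k < i → i ≤ k + d → f (u i) = u' i) :
    f (descProd u d k) = descProd u' d k := by
  induction d with
  | zero => simp [descProd]
  | succ d ih =>
    rw [descProd, descProd, map_mul, h _ (by omega) (by omega),
      ih fun i h₁ h₂ => h i (by omega) (by omega)]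

theorem commute_ascProd {x : M} {d k : ℕ} (h : ∀ i, k < i → i ≤ k + d → Commute x (u i)) :
    Commute x (ascProd u d k) := by
  induction d generalizing k with
  | zero => exact Commute.one_right x
  | succ d ih =>
    exact (h _ (by omega) (by omega)).mul_right (ih fun i h₁ h₂ => h i (by omega) (by omega))

theorem commute_descProd {x : M} {d k : ℕ} (h : ∀ i, k < i → i ≤ k + d → Commute x (u i)) :
    Commute x (descProd u d k) := by
  induction d with
  | zero => exact Commute.one_right x
  | succ d ih =>
    exact (h _ (by omega) (by omega)).mul_right (ih fun i h₁ h₂ => h i (by omega) (by omega))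

theorem semiconjBy_ascProd_shift {x : M} {d k m : ℕ}
    (h : ∀ i, k < i → i ≤ k + d → SemiconjBy x (u i) (u (m + i))) :
    SemiconjBy x (ascProd u d k) (ascProd u d (m + k)) := by
  induction d generalizing k with
  | zero => exact SemiconjBy.one_right x
  | succ d ih =>
    exact (h _ (by omega) (by omega)).mul_right (ih fun i h₁ h₂ => h i (by omega) (by omega))

theorem semiconjBy_descProd {x : M} {d k k' : ℕ}
    (h : ∀ i, 1 ≤ i → i ≤ d → SemiconjBy x (u (k + i)) (u (k' + i))) :
    SemiconjBy x (descProd u d k) (descProd u d k') := by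
  induction d with
  | zero => exact SemiconjBy.one_right x
  | succ d ih =>
    exact (h (d + 1) (by omega) (by omega)).mul_right (ih fun i h₁ h₂ => h i h₁ (by omega))

theorem ascProd_mem {S : Submonoid M} {d k : ℕ} (h : ∀ i, k < i → i ≤ k + d → u i ∈ S) :
    ascProd u d k ∈ S := by
  induction d generalizing k with
  | zero => exact S.one_mem
  | succ d ih =>
    exact S.mul_mem (h _ (by omega) (by omega)) (ih fun i h₁ h₂ => h i (by omega) (by omega))

/-- A sequence in a monoid satisfies the braid relations of `B_N`. -/
structure IsBraidSeq (N : ℕ) : Prop where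
  comm : ∀ i j, i + 1 < j → Commute (u i) (u j)
  braid : ∀ i, 1 ≤ i → i + 1 < N → u i * u (i + 1) * u i = u (i + 1) * u i * u (i + 1)

variable {u} {N : ℕ}

/-- Factors of index above `i + 1` commute with `u i`, the braid relation carries it through `u i *
u (i + 1)` as `u (i + 1)`, and the earlier factors commute with `u (i + 1)`. -/
theorem IsBraidSeq.semiconjBy_ascProd (hu : IsBraidSeq u N) {d k i : ℕ} (hN : k + d < N)
    (h₁ : k < i) (h₂ : i < k + d) : SemiconjBy (ascProd u d k) (u i) (u (i + 1)) := by
  induction d generalizing k with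
  | zero => omega
  | succ d ih =>
    rcases Nat.lt_or_ge (k + 1) i with h | h
    · exact SemiconjBy.mul_left (hu.comm _ _ (by omega)) (ih (by omega) h (by omega))
    · obtain rfl : i = k + 1 := by omega
      obtain ⟨d, rfl⟩ : ∃ e, d = e + 1 := ⟨d - 1, by omega⟩
      have hc : Commute (u (k + 1)) (ascProd u d (k + 1 + 1)) :=
        commute_ascProd u fun i h₁ h₂ => hu.comm _ _ (by omega)
      rw [SemiconjBy, ascProd, ascProd, mul_assoc, mul_assoc, ← hc.eq]
      simp only [← mul_assoc]
      rw [hu.braid _ (by omega) (by omega)]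

/-- The square of the Garside-type element `u (k + 1) ⋯ u (k + d)` conjugates the last factor to
the first. -/
theorem IsBraidSeq.semiconjBy_ascProd_sq (hu : IsBraidSeq u N) {d k : ℕ} (hN : k + d < N)
    (hd : 1 ≤ d) : SemiconjBy (ascProd u d k ^ 2) (u (k + d)) (u (k + 1)) := by
  obtain ⟨d, rfl⟩ : ∃ e, d = e + 1 := ⟨d - 1, by omega⟩
  -- Write `D = P * u_last = u_first * Q`. Shifting every factor of `P` gives `D * P = Q * D`, hence
  -- `D² * u_last = u_first * D * P * u_last = u_first * D²`.
  have h : SemiconjBy (ascProd u (d + 1) k) (ascProd u d k) (ascProd u d (1 + k)) :=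
    semiconjBy_ascProd_shift u fun i h₁ h₂ => by
      rw [add_comm 1 i]
      exact hu.semiconjBy_ascProd hN h₁ (by omega)
  have e₁ : ascProd u (d + 1) k = u (k + 1) * ascProd u d (1 + k) := by
    rw [ascProd, add_comm 1 k]
  calc ascProd u (d + 1) k ^ 2 * u (k + (d + 1))
      = u (k + 1) * ascProd u d (1 + k) * ascProd u (d + 1) k * u (k + d + 1) := by
        rw [sq, ← e₁, add_assoc]
    _ = u (k + 1) * (ascProd u (d + 1) k * (ascProd u d k * u (k + d + 1))) := by
        rw [mul_assoc (u (k + 1)), ← h.eq]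
        simp only [mul_assoc]
    _ = u (k + 1) * ascProd u (d + 1) k ^ 2 := by rw [← ascProd_succ_last, sq]

theorem IsBraidSeq.semiconjBy_ascProd_pow (hu : IsBraidSeq u N) {d k : ℕ} (hN : k + d < N)
    (m i : ℕ) (h₁ : k < i) (h₂ : i + m ≤ k + d) :
    SemiconjBy (ascProd u d k ^ m) (u i) (u (i + m)) := by
  induction m with
  | zero => simp
  | succ m ih =>
    rw [pow_succ', ← add_assoc]
    exact (hu.semiconjBy_ascProd hN (by omega) (by omega)).mul_left (ih (by omega))

/-- The element `D ^ b`, where `D = u (s + 1) ⋯ u (s + a + b - 1)`, moves a block of `a` strands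
to the right past a block of `b` strands. -/
theorem IsBraidSeq.semiconjBy_swap (hu : IsBraidSeq u N) {a b s : ℕ}
    (hN : s + (a + 1) + (b + 1) ≤ N) :
    SemiconjBy (ascProd u (a + b + 1) s ^ (b + 1))
      (descProd u a s * descProd u b (s + (a + 1)))
      (descProd u b s * descProd u a (s + (b + 1))) := by
  have h₁ : SemiconjBy (ascProd u (a + b + 1) s ^ (b + 1)) (descProd u a s)
      (descProd u a (s + (b + 1))) :=
    semiconjBy_descProd u fun i hi hi' => by
      rw [add_right_comm s (b + 1) i]
      exact hu.semiconjBy_ascProd_pow (by omega) _ _ (by omega) (by omega)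
  have h₂ : SemiconjBy (ascProd u (a + b + 1) s ^ (b + 1)) (descProd u b (s + (a + 1)))
      (descProd u b s) :=
    semiconjBy_descProd u fun i hi hi' => by
      -- Read from right to left: `b - i` shifts bring the generator to the last index, `D²` wraps
      -- it round to the first, and `i - 1` shifts bring it to `s + i`.
      have e : b + 1 = (i - 1) + (2 + (b - i)) := by omega
      rw [e, pow_add, pow_add]
      refine SemiconjBy.mul_left (y := u (s + 1)) ?_
        (SemiconjBy.mul_left (y := u (s + (a + b + 1))) ?_ ?_)
      · have := hu.semiconjBy_ascProd_pow (k := s) (d := a + b + 1) (by omega) (i - 1) (s + 1)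
          (by omega) (by omega)
        rwa [show s + 1 + (i - 1) = s + i by omega] at this
      · exact hu.semiconjBy_ascProd_sq (by omega) (by omega)
      · have := hu.semiconjBy_ascProd_pow (k := s) (d := a + b + 1) (by omega) (b - i)
          (s + (a + 1) + i) (by omega) (by omega)
        rwa [show s + (a + 1) + i + (b - i) = s + (a + b + 1) by omega] at this
  have hc : Commute (descProd u b s) (descProd u a (s + (b + 1))) :=
    commute_descProd u fun i hi hi' => Commute.symm <|
      commute_descProd u fun j hj hj' => (hu.comm j i (by omega)).symm
  rw [hc.eq]
  exact h₁.mul_right h₂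

/-- The product of `u` along the word `blockWord s l`. -/
def blockProd (u : ℕ → M) (s : ℕ) (l : List ℕ) : M := ((blockWord s l).map u).prod

theorem blockProd_nil (u : ℕ → M) (s : ℕ) : blockProd u s [] = 1 := by
  simp [blockProd, blockWord]

theorem blockProd_cons (u : ℕ → M) (s m : ℕ) (l : List ℕ) :
    blockProd u s (m :: l) = descProd u (m - 1) s * blockProd u (s + m) l := by
  simp only [blockProd, blockWord, List.map_append, List.prod_append, list_prod_eq_descProd]

theorem blockProd_concat (u : ℕ → M) (s m : ℕ) (l : List ℕ) :
    blockProd u s (l ++ [m]) = blockProd u s l * descProd u (m - 1) (s + l.sum) := by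
  induction l generalizing s with
  | nil => simp [blockProd_cons, blockProd_nil]
  | cons a l ih =>
    rw [List.cons_append, blockProd_cons, ih, blockProd_cons, mul_assoc, List.sum_cons, add_assoc]

theorem commute_blockProd {x : M} {s : ℕ} {l : List ℕ}
    (h : ∀ i, s < i → i < s + l.sum → Commute x (u i)) : Commute x (blockProd u s l) := by
  have hmem : blockProd u s l ∈ Submonoid.centralizer {x} := by
    refine Submonoid.list_prod_mem _ fun y hy => ?_
    obtain ⟨i, hi, rfl⟩ := List.mem_map.1 hy
    have := mem_blockWord _ _ hi
    rw [Submonoid.mem_centralizer_iff]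
    rintro _ rfl
    exact h i (by omega) (by omega)
  exact Submonoid.mem_centralizer_iff.1 hmem x rfl

theorem map_blockProd {M' F : Type*} [Monoid M'] [FunLike F M M'] [MonoidHomClass F M M'] (f : F)
    (u' : ℕ → M') (s : ℕ) (l : List ℕ) (h : ∀ i, s < i → i < s + l.sum → f (u i) = u' i) :
    f (blockProd u s l) = blockProd u' s l := by
  rw [blockProd, map_list_prod, List.map_map, blockProd]
  congr 1
  refine List.map_congr_left fun i hi => ?_
  have := mem_blockWord _ _ hi
  exact h i (by omega) (by omega)

/-- Reordering the blocks of a disjoint union of braids amounts to a conjugation. -/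
theorem IsBraidSeq.exists_semiconjBy_of_perm (hu : IsBraidSeq u N) {l l' : List ℕ}
    (h : l.Perm l') : ∀ s, s + l.sum ≤ N → (∀ m ∈ l, 1 ≤ m) →
      ∃ x ∈ Submonoid.closure (u '' {i | s < i ∧ i < s + l.sum}),
        SemiconjBy x (blockProd u s l) (blockProd u s l') := by
  induction h with
  | nil => exact fun s _ _ => ⟨1, Submonoid.one_mem _, SemiconjBy.one_left _⟩
  | @cons m l l' hp ih =>
    intro s hN hl
    simp only [List.sum_cons, List.mem_cons, forall_eq_or_imp] at hN hl ⊢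
    obtain ⟨x, hx, hxl⟩ := ih (s + m) (by omega) hl.2
    refine ⟨x, Submonoid.closure_mono (Set.image_mono fun i hi => ?_) hx, ?_⟩
    · simp only [Set.mem_ofPred_eq] at hi ⊢
      omega
    · rw [blockProd_cons, blockProd_cons]
      refine SemiconjBy.mul_right ?_ hxl
      -- The conjugator for the tail uses only indices above `s + m`, the first block only indices
      -- below `s + m`, so they commute. This is why the statement records where the conjugator
      -- lies.
      refine commute_descProd u fun j hj hj' => ?_
      have hle : Submonoid.closure (u '' {i | s + m < i ∧ i < s + m + l.sum}) ≤
          Submonoid.centralizer {u j} := by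
        rw [Submonoid.closure_le]
        rintro _ ⟨i, hi, rfl⟩
        simp only [Set.mem_ofPred_eq] at hi
        rw [SetLike.mem_coe, Submonoid.mem_centralizer_iff]
        rintro _ rfl
        exact hu.comm j i (by omega)
      exact (Submonoid.mem_centralizer_iff.1 (hle hx) (u j) rfl).symm
  | swap a b l =>
    intro s hN hl
    simp only [List.sum_cons, List.mem_cons, forall_eq_or_imp] at hN hl ⊢
    obtain ⟨a, rfl⟩ : ∃ e, a = e + 1 := ⟨a - 1, by omega⟩
    obtain ⟨b, rfl⟩ : ∃ e, b = e + 1 := ⟨b - 1, by omega⟩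
    refine ⟨ascProd u (b + a + 1) s ^ (a + 1), ?_, ?_⟩
    · exact Submonoid.pow_mem _ (ascProd_mem u fun i h₁ h₂ =>
        Submonoid.subset_closure (Set.mem_image_of_mem u
          (show s < i ∧ i < s + (b + 1 + (a + 1 + l.sum)) by omega))) _
    · simp only [blockProd_cons, Nat.add_sub_cancel, ← mul_assoc]
      rw [add_right_comm s (a + 1) (b + 1)]
      refine (hu.semiconjBy_swap (by omega)).mul_right (Commute.pow_left ?_ _)
      refine commute_blockProd fun i hi hi' => Commute.symm ?_
      exact commute_ascProd u fun j hj hj' => (hu.comm _ _ (by omega)).symm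
  | @trans l₁ l₂ l₃ h₁ h₂ ih₁ ih₂ =>
    intro s hN hl
    obtain ⟨x, hx, hxl⟩ := ih₁ s hN hl
    obtain ⟨y, hy, hyl⟩ := ih₂ s (h₁.sum_eq ▸ hN) fun m hm => hl m (h₁.mem_iff.2 hm)
    rw [← h₁.sum_eq] at hy
    exact ⟨y * x, Submonoid.mul_mem _ hy hx, hyl.mul_left hxl⟩

end Sequences

/-! ### Basic properties of the Iwahori-Hecke algebra -/

section HeckeBasic

variable {R : Type*} [CommRing R] (q₁ q₂ : Rˣ)

/-- The generator `Tᵢ` of `H_n(q₁, q₂)` for `1 ≤ i < n`, and the scalar `q₁` for other `i`. -/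
def heckeT (n i : ℕ) : Hecke q₁ q₂ n :=
  if h : 1 ≤ i ∧ i < n then gen q₁ q₂ ⟨i, h⟩ else algebraMap R _ (q₁ : R)

theorem heckeT_of_mem {n i : ℕ} (h : 1 ≤ i ∧ i < n) : heckeT q₁ q₂ n i = gen q₁ q₂ ⟨i, h⟩ :=
  dif_pos h

theorem heckeT_val {n : ℕ} (i : GenIdx n) : heckeT q₁ q₂ n i.1 = gen q₁ q₂ i :=
  heckeT_of_mem q₁ q₂ i.2

theorem heckeT_of_not_mem {n i : ℕ} (h : ¬(1 ≤ i ∧ i < n)) :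
    heckeT q₁ q₂ n i = algebraMap R _ (q₁ : R) :=
  dif_neg h

/-- The default value `q₁` is central, so far commutation needs no bounds on the indices; it is also
a root of the quadratic polynomial and a unit, which frees `heckeT_mul_self` and `isUnit_heckeT`
from bounds as well. -/
theorem isBraidSeq_heckeT (n : ℕ) : IsBraidSeq (heckeT q₁ q₂ n) n where
  comm i j h := by
    by_cases hi : 1 ≤ i ∧ i < n
    · by_cases hj : 1 ≤ j ∧ j < n
      · rw [heckeT_of_mem q₁ q₂ hi, heckeT_of_mem q₁ q₂ hj]
        exact gen_comm q₁ q₂ _ _ (Or.inl h)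
      · rw [heckeT_of_not_mem q₁ q₂ hj]
        exact (Algebra.commutes _ _).symm
    · rw [heckeT_of_not_mem q₁ q₂ hi]
      exact Algebra.commutes _ _
  braid i h₁ h₂ := by
    rw [heckeT_of_mem q₁ q₂ (i := i) ⟨h₁, by omega⟩,
      heckeT_of_mem q₁ q₂ (i := i + 1) ⟨by omega, h₂⟩]
    exact gen_braid q₁ q₂ _ _ (Or.inl rfl)

theorem heckeT_comm (n : ℕ) {i j : ℕ} (h : i + 1 < j ∨ j + 1 < i) :
    heckeT q₁ q₂ n i * heckeT q₁ q₂ n j = heckeT q₁ q₂ n j * heckeT q₁ q₂ n i := by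
  rcases h with h | h
  · exact (isBraidSeq_heckeT q₁ q₂ n).comm i j h
  · exact ((isBraidSeq_heckeT q₁ q₂ n).comm j i h).symm

theorem mul_self_eq_of_quad {A : Type*} [Ring A] [Algebra R A] {a b : R} {x : A}
    (h : (x - algebraMap R A a) * (x - algebraMap R A b) = 0) :
    x * x = (a + b) • x - (a * b) • (1 : A) := by
  rw [sub_mul, mul_sub, mul_sub, ← Algebra.commutes b x, ← Algebra.smul_def, ← Algebra.smul_def,
    ← map_mul, Algebra.algebraMap_eq_smul_one] at h
  rw [add_smul, ← sub_eq_zero, ← h]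
  abel

theorem quad_of_mul_self_eq {A : Type*} [Ring A] [Algebra R A] {a b : R} {x : A}
    (h : x * x = (a + b) • x - (a * b) • (1 : A)) :
    (x - algebraMap R A a) * (x - algebraMap R A b) = 0 := by
  rw [sub_mul, mul_sub, mul_sub, ← Algebra.commutes b x, ← Algebra.smul_def, ← Algebra.smul_def,
    ← map_mul, Algebra.algebraMap_eq_smul_one, h, add_smul]
  abel

theorem heckeT_mul_self (n i : ℕ) : heckeT q₁ q₂ n i * heckeT q₁ q₂ n i =
    ((q₁ : R) + q₂) • heckeT q₁ q₂ n i - ((q₁ : R) * q₂) • (1 : Hecke q₁ q₂ n) := by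
  apply mul_self_eq_of_quad
  by_cases hi : 1 ≤ i ∧ i < n
  · rw [heckeT_of_mem q₁ q₂ hi]
    exact gen_quad q₁ q₂ _
  · rw [heckeT_of_not_mem q₁ q₂ hi, sub_self, zero_mul]

theorem isUnit_heckeT (n i : ℕ) : IsUnit (heckeT q₁ q₂ n i) := by
  by_cases hi : 1 ≤ i ∧ i < n
  · rw [heckeT_of_mem q₁ q₂ hi]
    exact (genUnit q₁ q₂ _).isUnit
  · rw [heckeT_of_not_mem q₁ q₂ hi]
    exact q₁.isUnit.map _

variable {q₁ q₂}

theorem hecke_mul_induction {n : ℕ} {P : Hecke q₁ q₂ n → Prop}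
    (scalar : ∀ r : R, P (algebraMap R _ r)) (add : ∀ x y, P x → P y → P (x + y))
    (mul : ∀ x y, P x → P y → P (x * y))
    (gen : ∀ i, 1 ≤ i → i < n → P (heckeT q₁ q₂ n i)) (x : Hecke q₁ q₂ n) : P x := by
  obtain ⟨x, rfl⟩ : ∃ y, heckeMk q₁ q₂ n y = x := RingQuot.mkAlgHom_surjective R _ x
  induction x using FreeAlgebra.induction with
  | grade0 r => rw [AlgHom.commutes]; exact scalar r
  | grade1 i => have := gen i.1 i.2.1 i.2.2; rwa [heckeT_val] at this
  | mul a b ha hb => rw [map_mul]; exact mul _ _ ha hb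
  | add a b ha hb => rw [map_add]; exact add _ _ ha hb

/-- The universal property of `H_n(q₁, q₂)`, for a sequence of elements of an algebra. -/
theorem exists_hecke_lift {A : Type*} [Ring A] [Algebra R A] {n : ℕ} (f : ℕ → A)
    (hc : ∀ i j, 1 ≤ i → i + 1 < j → j < n → f i * f j = f j * f i)
    (hb : ∀ i, 1 ≤ i → i + 1 < n → f i * f (i + 1) * f i = f (i + 1) * f i * f (i + 1))
    (hs : ∀ i, 1 ≤ i → i < n →
      f i * f i = ((q₁ : R) + q₂) • f i - ((q₁ : R) * q₂) • (1 : A)) :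
    ∃ φ : Hecke q₁ q₂ n →ₐ[R] A, ∀ i, 1 ≤ i → i < n → φ (heckeT q₁ q₂ n i) = f i := by
  refine ⟨RingQuot.liftAlgHom R ⟨FreeAlgebra.lift R fun i : GenIdx n => f i.1, ?_⟩, ?_⟩
  · intro x y h
    cases h with
    | comm i j h =>
      simp only [map_mul, FreeAlgebra.lift_ι_apply]
      rcases h with h | h
      · exact hc _ _ i.2.1 h j.2.2
      · exact (hc _ _ j.2.1 h i.2.2).symm
    | braid i j h =>
      simp only [map_mul, FreeAlgebra.lift_ι_apply]
      rcases h with h | h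
      · rw [← h]
        exact hb _ i.2.1 (h ▸ j.2.2)
      · rw [← h]
        exact (hb _ j.2.1 (h ▸ i.2.2)).symm
    | quad i =>
      simp only [map_mul, map_sub, FreeAlgebra.lift_ι_apply, AlgHom.commutes, map_zero]
      exact quad_of_mul_self_eq (hs _ i.2.1 i.2.2)
  · intro i h₁ h₂
    rw [heckeT_of_mem q₁ q₂ ⟨h₁, h₂⟩, gen, heckeMk]
    exact (RingQuot.liftAlgHom_mkAlgHom_apply R _ _ _).trans (FreeAlgebra.lift_ι_apply _ _)

theorem hecke_algHom_ext {A : Type*} [Ring A] [Algebra R A] {n : ℕ}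
    {φ ψ : Hecke q₁ q₂ n →ₐ[R] A}
    (h : ∀ i, 1 ≤ i → i < n → φ (heckeT q₁ q₂ n i) = ψ (heckeT q₁ q₂ n i)) : φ = ψ := by
  ext x
  induction x using hecke_mul_induction with
  | scalar r => rw [AlgHom.commutes, AlgHom.commutes]
  | add x y hx hy => rw [map_add, map_add, hx, hy]
  | mul x y hx hy => rw [map_mul, map_mul, hx, hy]
  | gen i h₁ h₂ => exact h i h₁ h₂

theorem heckeIncl_gen {n : ℕ} (i : GenIdx n) :
    heckeIncl q₁ q₂ n (gen q₁ q₂ i) = gen q₁ q₂ i.incl :=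
  (RingQuot.liftAlgHom_mkAlgHom_apply R _ _ _).trans (FreeAlgebra.lift_ι_apply _ _)

theorem heckeIncl_heckeT {n i : ℕ} (h : i < n) :
    heckeIncl q₁ q₂ n (heckeT q₁ q₂ n i) = heckeT q₁ q₂ (n + 1) i := by
  by_cases hi : 1 ≤ i ∧ i < n
  · rw [heckeT_of_mem q₁ q₂ hi, heckeT_of_mem q₁ q₂ (n := n + 1) ⟨hi.1, by omega⟩, heckeIncl_gen]
    rfl
  · rw [heckeT_of_not_mem q₁ q₂ hi, heckeT_of_not_mem q₁ q₂ (n := n + 1) (by omega),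
      AlgHom.commutes]

theorem exists_algebraMap_eq {n : ℕ} (hn : n ≤ 1) (x : Hecke q₁ q₂ n) :
    ∃ r : R, algebraMap R _ r = x := by
  induction x using hecke_mul_induction with
  | scalar r => exact ⟨r, rfl⟩
  | add x y hx hy =>
    obtain ⟨r, rfl⟩ := hx
    obtain ⟨s, rfl⟩ := hy
    exact ⟨r + s, map_add _ _ _⟩
  | mul x y hx hy =>
    obtain ⟨r, rfl⟩ := hx
    obtain ⟨s, rfl⟩ := hy
    exact ⟨r * s, map_mul _ _ _⟩
  | gen i h₁ h₂ => omega

/-- An element commuting with the images of the generators commutes with the image of `H_n`. -/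
theorem commute_map_heckeT {A : Type*} [Ring A] [Algebra R A] {n : ℕ} (φ : Hecke q₁ q₂ n →ₐ[R] A)
    {y : A} (h : ∀ i, 1 ≤ i → i < n → Commute (φ (heckeT q₁ q₂ n i)) y) (x : Hecke q₁ q₂ n) :
    Commute (φ x) y := by
  induction x using hecke_mul_induction with
  | scalar r => rw [AlgHom.commutes]; exact Algebra.commutes _ _
  | add x x' hx hx' => rw [map_add]; exact hx.add_left hx'
  | mul x x' hx hx' => rw [map_mul]; exact hx.mul_left hx'
  | gen i h₁ h₂ => exact h i h₁ h₂

end HeckeBasic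

/-! ### `H_{n+1}` as a right module over `H_n` -/

section Regular

variable {R : Type*} [CommRing R] (q₁ q₂ : Rˣ) (n : ℕ)

/-- The action of `Tᵢ` by left multiplication on the right `H_n`-module `H_{n+1}`, in coordinates
with respect to the basis `T_{k+1} ⋯ T_n`, `0 ≤ k ≤ n`. (The coordinates with `k > n` are
irrelevant.) -/
def regularOp (i : ℕ) : Module.End R (ℕ → Hecke q₁ q₂ n) where
  -- With `e_k = T_{k+1} ⋯ T_n`: `Tᵢ e_k` is `e_k T_{i-1}` if `k + 1 < i`, `(q₁ + q₂) e_k - q₁ q₂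
  -- e_{k+1}` if `k + 1 = i`, `e_{k-1}` if `k = i`, and `e_k Tᵢ` if `k > i`. The cases collect the
  -- coefficient of `e_k`.
  toFun f k :=
    if k + 1 < i then heckeT q₁ q₂ n (i - 1) * f k
    else if k + 1 = i then f i + ((q₁ : R) + q₂) • f k
    else if k = i then -(((q₁ : R) * q₂) • f (k - 1))
    else if k ≤ n then heckeT q₁ q₂ n i * f k
    else (q₁ : R) • f k
  map_add' f g := by
    ext k
    simp only [Pi.add_apply]
    split_ifs
    · rw [mul_add]
    · rw [smul_add]; abel
    · rw [smul_add]; abel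
    · rw [mul_add]
    · rw [smul_add]
  map_smul' r f := by
    ext k
    simp only [Pi.smul_apply, RingHom.id_apply]
    split_ifs
    · rw [mul_smul_comm]
    · rw [smul_add, smul_comm]
    · rw [smul_neg, smul_comm]
    · rw [mul_smul_comm]
    · rw [smul_comm]

variable {q₁ q₂ n}

theorem regularOp_lt {i k : ℕ} (h : k + 1 < i) (f : ℕ → Hecke q₁ q₂ n) :
    regularOp q₁ q₂ n i f k = heckeT q₁ q₂ n (i - 1) * f k := if_pos h

theorem regularOp_pred (k : ℕ) (f : ℕ → Hecke q₁ q₂ n) :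
    regularOp q₁ q₂ n (k + 1) f k = f (k + 1) + ((q₁ : R) + q₂) • f k := by
  simp [regularOp]

theorem regularOp_self (k : ℕ) (f : ℕ → Hecke q₁ q₂ n) :
    regularOp q₁ q₂ n (k + 1) f (k + 1) = -(((q₁ : R) * q₂) • f k) := by
  simp [regularOp]

theorem regularOp_gt {i k : ℕ} (h : i < k) (hk : k ≤ n) (f : ℕ → Hecke q₁ q₂ n) :
    regularOp q₁ q₂ n i f k = heckeT q₁ q₂ n i * f k := by
  simp [regularOp, show ¬ k + 1 < i by omega, show ¬ k + 1 = i by omega, show ¬ k = i by omega, hk]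

/-- Past `n` a common scalar is needed: `heckeT` at `n - 1` and at `n`, where it is `q₁`, need not
satisfy the braid relation. The root `q₁` keeps the quadratic relation. -/
theorem regularOp_junk {i k : ℕ} (h : i < k) (hk : n < k) (f : ℕ → Hecke q₁ q₂ n) :
    regularOp q₁ q₂ n i f k = (q₁ : R) • f k := by
  simp [regularOp, show ¬ k + 1 < i by omega, show ¬ k + 1 = i by omega, show ¬ k = i by omega,
    show ¬ k ≤ n by omega]

theorem regularOp_mul_self {i : ℕ} (h₁ : 1 ≤ i) (h₂ : i ≤ n) :
    regularOp q₁ q₂ n i * regularOp q₁ q₂ n i =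
      ((q₁ : R) + q₂) • regularOp q₁ q₂ n i - ((q₁ : R) * q₂) • 1 := by
  obtain ⟨i, rfl⟩ : ∃ j, i = j + 1 := ⟨i - 1, by omega⟩
  ext f k
  simp only [Module.End.mul_apply, LinearMap.sub_apply, LinearMap.smul_apply, Pi.sub_apply,
    Pi.smul_apply, Module.End.one_apply]
  rcases lt_trichotomy (k + 1) (i + 1) with h | h | h
  · simp only [regularOp_lt h]
    rw [← mul_assoc, heckeT_mul_self, sub_mul, smul_mul_assoc, smul_mul_assoc, one_mul]
  · obtain rfl : k = i := by omega
    simp only [regularOp_pred, regularOp_self]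
    abel
  · rcases Nat.lt_or_ge (i + 1) k with h' | h'
    · by_cases hk : k ≤ n
      · simp only [regularOp_gt h' hk]
        rw [← mul_assoc, heckeT_mul_self, sub_mul, smul_mul_assoc, smul_mul_assoc, one_mul]
      · simp only [regularOp_junk h' (not_le.1 hk), smul_smul, ← sub_smul]
        congr 1
        ring
    · obtain rfl : k = i + 1 := by omega
      simp only [regularOp_self, regularOp_pred]
      module

theorem regularOp_comm {i j : ℕ} (h₁ : 1 ≤ i) (h : i + 1 < j) (h₂ : j ≤ n) :
    regularOp q₁ q₂ n i * regularOp q₁ q₂ n j = regularOp q₁ q₂ n j * regularOp q₁ q₂ n i := by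
  obtain ⟨i, rfl⟩ : ∃ e, i = e + 1 := ⟨i - 1, by omega⟩
  obtain ⟨j, rfl⟩ : ∃ e, j = e + 1 := ⟨j - 1, by omega⟩
  ext f k
  simp only [Module.End.mul_apply]
  rcases lt_trichotomy k i with h' | rfl | h'
  · simp only [regularOp_lt (show k + 1 < i + 1 by omega),
      regularOp_lt (show k + 1 < j + 1 by omega), ← mul_assoc]
    rw [heckeT_comm _ _ _ (by omega)]
  · simp only [regularOp_pred, regularOp_lt (show k + 1 < j + 1 by omega),
      regularOp_lt (show k + 1 + 1 < j + 1 by omega), mul_add, mul_smul_comm]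
  · rcases lt_trichotomy k (i + 1) with h'' | rfl | h''
    · omega
    · simp only [regularOp_self, regularOp_lt (show i + 1 < j + 1 by omega),
        regularOp_lt (show i + 1 + 1 < j + 1 by omega), mul_neg, mul_smul_comm]
    · rcases lt_trichotomy k j with h₃ | rfl | h₃
      · simp only [regularOp_gt (show i + 1 < k by omega) (show k ≤ n by omega),
          regularOp_lt (show k + 1 < j + 1 by omega), ← mul_assoc]
        rw [heckeT_comm _ _ _ (by omega)]
      · simp only [regularOp_pred, regularOp_gt (show i + 1 < k by omega) (show k ≤ n by omega),
          regularOp_gt (show i + 1 < k + 1 by omega) (show k + 1 ≤ n by omega), mul_add,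
          mul_smul_comm]
      · rcases lt_trichotomy k (j + 1) with h₄ | rfl | h₄
        · omega
        · simp only [regularOp_self, regularOp_gt (show i + 1 < j by omega) (show j ≤ n by omega),
            regularOp_gt (show i + 1 < j + 1 by omega) (show j + 1 ≤ n by omega), mul_neg,
            mul_smul_comm]
        · by_cases hk : k ≤ n
          · simp only [regularOp_gt (show i + 1 < k by omega) hk,
              regularOp_gt (show j + 1 < k by omega) hk, ← mul_assoc]
            rw [heckeT_comm _ _ _ (by omega)]
          · simp only [regularOp_junk (show i + 1 < k by omega) (not_le.1 hk),
              regularOp_junk (show j + 1 < k by omega) (not_le.1 hk)]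

/-- Only the coordinates `i - 1`, `i`, `i + 1` get mixed. Any other coordinate up to `n` is
multiplied by two neighbouring generators of `H_n`, whose braid relation applies. -/
theorem regularOp_braid {i : ℕ} (h₁ : 1 ≤ i) (h₂ : i + 1 ≤ n) :
    regularOp q₁ q₂ n i * regularOp q₁ q₂ n (i + 1) * regularOp q₁ q₂ n i =
      regularOp q₁ q₂ n (i + 1) * regularOp q₁ q₂ n i * regularOp q₁ q₂ n (i + 1) := by
  obtain ⟨i, rfl⟩ : ∃ e, i = e + 1 := ⟨i - 1, by omega⟩
  ext f k
  simp only [Module.End.mul_apply]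
  have hT := heckeT_mul_self q₁ q₂ n (i + 1)
  rcases lt_trichotomy k i with h' | rfl | h'
  · simp only [regularOp_lt (show k + 1 < i + 1 by omega),
      regularOp_lt (show k + 1 < i + 1 + 1 by omega), ← mul_assoc, Nat.add_sub_cancel]
    rw [(isBraidSeq_heckeT q₁ q₂ n).braid i (by omega) (by omega)]
  · simp only [regularOp_pred, regularOp_self, regularOp_lt (show k + 1 < k + 1 + 1 by omega),
      Nat.add_sub_cancel, regularOp_gt (show k + 1 < k + 1 + 1 by omega) h₂, mul_add,
      mul_smul_comm, ← mul_assoc, hT, sub_mul, smul_mul_assoc, one_mul]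
    module
  · rcases lt_trichotomy k (i + 1) with h'' | rfl | h''
    · omega
    · simp only [regularOp_pred, regularOp_self, regularOp_lt (show i + 1 < i + 1 + 1 by omega),
        Nat.add_sub_cancel, regularOp_gt (show i + 1 < i + 1 + 1 by omega) h₂, mul_add,
        mul_smul_comm, mul_neg]
      module
    · rcases lt_trichotomy k (i + 1 + 1) with h₃ | rfl | h₃
      · omega
      · simp only [regularOp_self, regularOp_lt (show i + 1 < i + 1 + 1 by omega),
          Nat.add_sub_cancel, regularOp_gt (show i + 1 < i + 1 + 1 by omega) h₂,
          mul_smul_comm, mul_neg, smul_neg]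
      · by_cases hk : k ≤ n
        · simp only [regularOp_gt (show i + 1 < k by omega) hk,
            regularOp_gt (show i + 1 + 1 < k by omega) hk, ← mul_assoc]
          rw [(isBraidSeq_heckeT q₁ q₂ n).braid (i + 1) (by omega) (by omega)]
        · simp only [regularOp_junk (show i + 1 < k by omega) (not_le.1 hk),
            regularOp_junk (show i + 1 + 1 < k by omega) (not_le.1 hk)]

/-- Since the operators satisfy the relations, coordinates of `x` are well defined as the action of
`x` on `Pi.single n 1`; no prior knowledge that the `T_{k+1} ⋯ T_n` are independent is needed. -/
theorem exists_regular_rep (q₁ q₂ : Rˣ) (n : ℕ) :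
    ∃ φ : Hecke q₁ q₂ (n + 1) →ₐ[R] Module.End R (ℕ → Hecke q₁ q₂ n),
      ∀ i, 1 ≤ i → i < n + 1 → φ (heckeT q₁ q₂ (n + 1) i) = regularOp q₁ q₂ n i :=
  exists_hecke_lift _ (fun _ _ h₁ h h₂ => regularOp_comm h₁ h (Nat.lt_succ_iff.1 h₂))
    (fun _ h₁ h₂ => regularOp_braid h₁ (Nat.lt_succ_iff.1 h₂))
    (fun _ h₁ h₂ => regularOp_mul_self h₁ (Nat.lt_succ_iff.1 h₂))

/-- Left multiplication on the right `H_n`-module `H_{n+1}`, in coordinates. -/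
def regularRep (q₁ q₂ : Rˣ) (n : ℕ) :
    Hecke q₁ q₂ (n + 1) →ₐ[R] Module.End R (ℕ → Hecke q₁ q₂ n) :=
  (exists_regular_rep q₁ q₂ n).choose

theorem regularRep_heckeT {i : ℕ} (h₁ : 1 ≤ i) (h₂ : i ≤ n) :
    regularRep q₁ q₂ n (heckeT q₁ q₂ (n + 1) i) = regularOp q₁ q₂ n i :=
  (exists_regular_rep q₁ q₂ n).choose_spec i h₁ (Nat.lt_succ_iff.2 h₂)

end Regular

/-! ### The conditional expectation -/

section CondExp

variable {R : Type*} [CommRing R] {q₁ q₂ : Rˣ} {n : ℕ}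

/-- Any row `e` on which `t` acts by the same rules as `T_{i+1}` on the `T_{k+1} ⋯ T_n` is
compatible with `regularOp`. It serves twice: for that family itself, and for its images under the
conditional expectation. -/
theorem mul_sum_row {A : Type*} [Ring A] [Algebra R A] (φ : Hecke q₁ q₂ n →ₐ[R] A) (e : ℕ → A)
    (t : A) {i : ℕ} (hi : i + 1 ≤ n)
    (hlt : ∀ k < i, t * e k = e k * φ (heckeT q₁ q₂ n i))
    (hpred : t * e i = ((q₁ : R) + q₂) • e i - ((q₁ : R) * q₂) • e (i + 1))
    (hself : t * e (i + 1) = e i)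
    (hgt : ∀ k, i + 1 < k → k ≤ n → t * e k = e k * φ (heckeT q₁ q₂ n (i + 1)))
    (f : ℕ → Hecke q₁ q₂ n) :
    t * ∑ k ∈ Finset.range (n + 1), e k * φ (f k) =
      ∑ k ∈ Finset.range (n + 1), e k * φ (regularOp q₁ q₂ n (i + 1) f k) := by
  rw [← sub_eq_zero, Finset.mul_sum, ← Finset.sum_sub_distrib,
    Finset.sum_eq_add i (i + 1) (by omega)]
  · rw [regularOp_pred, regularOp_self, ← mul_assoc, ← mul_assoc, hpred, hself]
    simp only [map_add, map_neg, map_smul, mul_add, mul_neg, sub_mul, smul_mul_assoc,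
      mul_smul_comm]
    abel
  · intro k hk hne
    rw [Finset.mem_range] at hk
    rcases Nat.lt_or_ge k i with h | h
    · rw [regularOp_lt (by omega), Nat.add_sub_cancel, map_mul, ← mul_assoc, ← mul_assoc, hlt k h,
        sub_self]
    · rw [regularOp_gt (by omega) (by omega), map_mul, ← mul_assoc, ← mul_assoc,
        hgt k (by omega) (by omega), sub_self]
  · intro h
    exact absurd (Finset.mem_range.2 (by omega)) h
  · intro h
    exact absurd (Finset.mem_range.2 (by omega)) h

theorem ascProd_heckeT_lt (N : ℕ) {d k i : ℕ} (hN : k + d < N) (h₁ : k < i) (h₂ : i < k + d) :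
    heckeT q₁ q₂ N (i + 1) * ascProd (heckeT q₁ q₂ N) d k =
      ascProd (heckeT q₁ q₂ N) d k * heckeT q₁ q₂ N i :=
  ((isBraidSeq_heckeT q₁ q₂ N).semiconjBy_ascProd hN h₁ h₂).symm

theorem heckeT_mul_ascProd_self (N d k : ℕ) :
    heckeT q₁ q₂ N (k + 1) * ascProd (heckeT q₁ q₂ N) (d + 1) k =
      ((q₁ : R) + q₂) • ascProd (heckeT q₁ q₂ N) (d + 1) k -
        ((q₁ : R) * q₂) • ascProd (heckeT q₁ q₂ N) d (k + 1) := by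
  rw [ascProd, ← mul_assoc, heckeT_mul_self, sub_mul, smul_mul_assoc, smul_mul_assoc, one_mul]

theorem heckeT_mul_ascProd_gt (N : ℕ) {d k i : ℕ} (h : i < k) :
    heckeT q₁ q₂ N i * ascProd (heckeT q₁ q₂ N) d k =
      ascProd (heckeT q₁ q₂ N) d k * heckeT q₁ q₂ N i :=
  commute_ascProd _ fun j h₁ _ => heckeT_comm q₁ q₂ N (by omega)

/-- The basis element `T_{k+1} ⋯ T_n` of the right `H_n`-module `H_{n+1}`. -/
def cosetElt (q₁ q₂ : Rˣ) (n k : ℕ) : Hecke q₁ q₂ (n + 1) :=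
  ascProd (heckeT q₁ q₂ (n + 1)) (n - k) k

theorem heckeT_mul_sum_cosetElt {i : ℕ} (h₁ : 1 ≤ i) (h₂ : i ≤ n) (f : ℕ → Hecke q₁ q₂ n) :
    heckeT q₁ q₂ (n + 1) i *
        ∑ k ∈ Finset.range (n + 1), cosetElt q₁ q₂ n k * heckeIncl q₁ q₂ n (f k) =
      ∑ k ∈ Finset.range (n + 1),
        cosetElt q₁ q₂ n k * heckeIncl q₁ q₂ n (regularOp q₁ q₂ n i f k) := by
  obtain ⟨i, rfl⟩ : ∃ e, i = e + 1 := ⟨i - 1, by omega⟩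
  refine mul_sum_row _ _ _ h₂ (fun k hk => ?_) ?_ ?_ (fun k hk hk' => ?_) f
  · rw [heckeIncl_heckeT (by omega)]
    exact ascProd_heckeT_lt _ (by omega) (by omega) (by omega)
  · rw [cosetElt, cosetElt, show n - i = n - (i + 1) + 1 by omega]
    exact heckeT_mul_ascProd_self _ _ _
  · rw [cosetElt, cosetElt, show n - i = n - (i + 1) + 1 by omega]
    rfl
  · rw [heckeIncl_heckeT (by omega)]
    exact heckeT_mul_ascProd_gt _ (by omega)

/-- Taking `f = Pi.single n 1`, the coordinates of `1`, expands an arbitrary `x` in the elements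
`cosetElt`. -/
theorem mul_sum_cosetElt (x : Hecke q₁ q₂ (n + 1)) (f : ℕ → Hecke q₁ q₂ n) :
    x * ∑ k ∈ Finset.range (n + 1), cosetElt q₁ q₂ n k * heckeIncl q₁ q₂ n (f k) =
      ∑ k ∈ Finset.range (n + 1),
        cosetElt q₁ q₂ n k * heckeIncl q₁ q₂ n (regularRep q₁ q₂ n x f k) := by
  induction x using hecke_mul_induction generalizing f with
  | scalar r =>
    simp only [AlgHom.commutes, Module.algebraMap_end_apply, Pi.smul_apply, map_smul,
      mul_smul_comm, ← Finset.smul_sum]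
    rw [Algebra.smul_def]
  | add x y hx hy =>
    simp only [add_mul, hx, hy, map_add, LinearMap.add_apply, Pi.add_apply, mul_add,
      Finset.sum_add_distrib]
  | mul x y hx hy => rw [mul_assoc, hy, hx, map_mul, Module.End.mul_apply]
  | gen i h₁ h₂ =>
    rw [heckeT_mul_sum_cosetElt h₁ (by omega), regularRep_heckeT h₁ (by omega)]

theorem sum_cosetElt_single :
    ∑ k ∈ Finset.range (n + 1),
      cosetElt q₁ q₂ n k * heckeIncl q₁ q₂ n ((Pi.single n 1 : ℕ → Hecke q₁ q₂ n) k) = 1 := by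
  rw [Finset.sum_eq_single n]
  · simp [cosetElt, ascProd]
  · intro k _ hk
    simp [hk]
  · simp

/-- `H_{n+1} = H_n + H_n T_n H_n`. -/
theorem hecke_succ_induction {P : Hecke q₁ q₂ (n + 1) → Prop}
    (add : ∀ x y, P x → P y → P (x + y)) (incl : ∀ a, P (heckeIncl q₁ q₂ n a))
    (mul : 1 ≤ n → ∀ a b, P (heckeIncl q₁ q₂ n a * heckeT q₁ q₂ (n + 1) n * heckeIncl q₁ q₂ n b))
    (x : Hecke q₁ q₂ (n + 1)) : P x := by
  have h := mul_sum_cosetElt x (Pi.single n 1)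
  rw [sum_cosetElt_single, mul_one] at h
  rw [h]
  refine Finset.sum_induction _ P add (by simpa using incl 0) fun k hk => ?_
  rw [Finset.mem_range] at hk
  rcases Nat.lt_or_ge k n with h | h
  · have e : cosetElt q₁ q₂ n k =
        heckeIncl q₁ q₂ n (ascProd (heckeT q₁ q₂ n) (n - k - 1) k) * heckeT q₁ q₂ (n + 1) n := by
      rw [cosetElt, show n - k = n - k - 1 + 1 by omega, ascProd_succ_last,
        map_ascProd _ _ (heckeT q₁ q₂ (n + 1)) _ _ fun i h₁ h₂ => heckeIncl_heckeT (by omega)]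
      congr 2
      omega
    rw [e]
    exact mul (by omega) _ _
  · obtain rfl : k = n := by omega
    simpa [cosetElt, ascProd] using incl _

theorem regularRep_mul_right (x : Hecke q₁ q₂ (n + 1)) (f : ℕ → Hecke q₁ q₂ n)
    (a : Hecke q₁ q₂ n) :
    regularRep q₁ q₂ n x (fun k => f k * a) = fun k => regularRep q₁ q₂ n x f k * a := by
  induction x using hecke_mul_induction generalizing f with
  | scalar r =>
    ext k
    simp only [AlgHom.commutes, Module.algebraMap_end_apply, Pi.smul_apply, smul_mul_assoc]
  | add x y hx hy =>
    ext k
    simp only [map_add, LinearMap.add_apply, Pi.add_apply, hx, hy, add_mul]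
  | mul x y hx hy => simp only [map_mul, Module.End.mul_apply, hx, hy]
  | gen i h₁ h₂ =>
    rw [regularRep_heckeT h₁ (by omega)]
    ext k
    simp only [regularOp, LinearMap.coe_mk, AddHom.coe_mk]
    split_ifs <;> simp only [mul_assoc, add_mul, neg_mul, smul_mul_assoc]

theorem regularRep_incl_single (x y : Hecke q₁ q₂ n) :
    regularRep q₁ q₂ n (heckeIncl q₁ q₂ n x) (Pi.single n y) =
      (Pi.single n (x * y) : ℕ → Hecke q₁ q₂ n) := by
  induction x using hecke_mul_induction generalizing y with
  | scalar r =>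
    rw [AlgHom.commutes, AlgHom.commutes, Module.algebraMap_end_apply, ← Pi.single_smul,
      Algebra.smul_def]
  | add a b ha hb => rw [map_add, map_add, LinearMap.add_apply, ha, hb, add_mul, Pi.single_add]
  | mul a b ha hb => rw [map_mul, map_mul, Module.End.mul_apply, hb, ha, mul_assoc]
  | gen i h₁ h₂ =>
    rw [heckeIncl_heckeT h₂, regularRep_heckeT h₁ (by omega)]
    obtain ⟨i, rfl⟩ : ∃ e, i = e + 1 := ⟨i - 1, by omega⟩
    ext k
    rcases lt_trichotomy k i with h | rfl | h
    · simp [regularOp_lt (show k + 1 < i + 1 by omega), show k ≠ n by omega]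
    · simp [regularOp_pred, show k ≠ n by omega, show k + 1 ≠ n by omega]
    · rcases Nat.lt_or_ge (i + 1) k with h' | h'
      · by_cases hk : k ≤ n
        · rw [regularOp_gt h' hk]
          rcases eq_or_ne k n with rfl | hne
          · simp
          · simp [hne]
        · simp [regularOp_junk h' (not_le.1 hk), show k ≠ n by omega]
      · obtain rfl : k = i + 1 := by omega
        simp [regularOp_self, show i ≠ n by omega, show i + 1 ≠ n by omega]

/-- The conditional expectation `H_{n+1} → H_n` with `a T_n b ↦ a b` and `a ↦ z a` for
`a, b ∈ H_n`. -/
def condExp (q₁ q₂ : Rˣ) (z : R) (n : ℕ) : Hecke q₁ q₂ (n + 1) →ₗ[R] Hecke q₁ q₂ n where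
  -- The coefficients are the prescribed images of the `T_{k+1} ⋯ T_n`: the final `T_n` is deleted
  -- when `k < n`, and the empty product goes to `z`.
  toFun x := ∑ k ∈ Finset.range (n + 1),
    (if k < n then ascProd (heckeT q₁ q₂ n) (n - 1 - k) k else z • 1) *
      regularRep q₁ q₂ n x (Pi.single n 1) k
  map_add' x y := by
    simp only [map_add, LinearMap.add_apply, Pi.add_apply, mul_add, Finset.sum_add_distrib]
  map_smul' r x := by
    simp only [map_smul, LinearMap.smul_apply, Pi.smul_apply, mul_smul_comm, Finset.smul_sum,
      RingHom.id_apply]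

variable (z : R)

theorem condExp_one : condExp q₁ q₂ z n 1 = z • 1 := by
  simp only [condExp, LinearMap.coe_mk, AddHom.coe_mk, map_one, Module.End.one_apply]
  rw [Finset.sum_eq_single n]
  · simp
  · intro k _ hk
    simp [hk]
  · simp

theorem condExp_heckeT (hn : 1 ≤ n) : condExp q₁ q₂ z n (heckeT q₁ q₂ (n + 1) n) = 1 := by
  simp only [condExp, LinearMap.coe_mk, AddHom.coe_mk, regularRep_heckeT hn le_rfl]
  obtain ⟨m, rfl⟩ : ∃ m, n = m + 1 := ⟨n - 1, by omega⟩
  rw [Finset.sum_eq_single m]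
  · simp [regularOp_pred, ascProd]
  · intro k hk hne
    rw [Finset.mem_range] at hk
    rcases Nat.lt_or_ge k m with h | h
    · rw [regularOp_lt (by omega), Pi.single_eq_of_ne (by omega), mul_zero, mul_zero]
    · obtain rfl : k = m + 1 := by omega
      rw [regularOp_self, Pi.single_eq_of_ne (by omega), smul_zero, neg_zero, mul_zero]
  · simp

theorem condExp_mul_incl (x : Hecke q₁ q₂ (n + 1)) (a : Hecke q₁ q₂ n) :
    condExp q₁ q₂ z n (x * heckeIncl q₁ q₂ n a) = condExp q₁ q₂ z n x * a := by
  simp only [condExp, LinearMap.coe_mk, AddHom.coe_mk, map_mul, Module.End.mul_apply,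
    regularRep_incl_single, mul_one, Finset.sum_mul, mul_assoc]
  have h : (Pi.single n a : ℕ → Hecke q₁ q₂ n) =
      fun k => (Pi.single n 1 : ℕ → Hecke q₁ q₂ n) k * a := by
    ext k
    rcases eq_or_ne k n with rfl | hk
    · simp
    · simp [hk]
  rw [h, regularRep_mul_right]

theorem condExp_heckeT_mul {i : ℕ} (h₁ : 1 ≤ i) (h₂ : i < n) (x : Hecke q₁ q₂ (n + 1)) :
    condExp q₁ q₂ z n (heckeT q₁ q₂ (n + 1) i * x) =
      heckeT q₁ q₂ n i * condExp q₁ q₂ z n x := by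
  simp only [condExp, LinearMap.coe_mk, AddHom.coe_mk, map_mul, Module.End.mul_apply,
    regularRep_heckeT h₁ h₂.le]
  obtain ⟨i, rfl⟩ : ∃ e, i = e + 1 := ⟨i - 1, by omega⟩
  -- The row of images obeys the same rules inside `H_n`. Since `i + 1 < n`, its last entry `z` is
  -- only required to commute with a generator, so `z` is unconstrained.
  refine (mul_sum_row (AlgHom.id R _) _ _ h₂.le (fun k hk => ?_) ?_ ?_ (fun k hk hk' => ?_) _).symm
  · rw [if_pos (by omega)]
    exact ascProd_heckeT_lt _ (by omega) (by omega) (by omega)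
  · rw [if_pos (by omega), if_pos h₂, show n - 1 - i = n - 1 - (i + 1) + 1 by omega]
    exact heckeT_mul_ascProd_self _ _ _
  · rw [if_pos h₂, if_pos (show i < n by omega), show n - 1 - i = n - 1 - (i + 1) + 1 by omega]
    rfl
  · split_ifs
    · exact heckeT_mul_ascProd_gt _ (by omega)
    · simp

theorem condExp_incl_mul (a : Hecke q₁ q₂ n) (x : Hecke q₁ q₂ (n + 1)) :
    condExp q₁ q₂ z n (heckeIncl q₁ q₂ n a * x) = a * condExp q₁ q₂ z n x := by
  induction a using hecke_mul_induction generalizing x with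
  | scalar r => rw [AlgHom.commutes, ← Algebra.smul_def, ← Algebra.smul_def, map_smul]
  | add a b ha hb => rw [map_add, add_mul, add_mul, map_add, ha, hb]
  | mul a b ha hb => rw [map_mul (heckeIncl q₁ q₂ n), mul_assoc, ha, hb, mul_assoc]
  | gen i h₁ h₂ => rw [heckeIncl_heckeT h₂, condExp_heckeT_mul z h₁ h₂]

theorem condExp_incl (a : Hecke q₁ q₂ n) :
    condExp q₁ q₂ z n (heckeIncl q₁ q₂ n a) = z • a := by
  rw [← mul_one (heckeIncl q₁ q₂ n a), condExp_incl_mul, condExp_one, mul_smul_comm, mul_one]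

theorem commute_incl_incl_heckeT (a : Hecke q₁ q₂ n) :
    Commute (heckeIncl q₁ q₂ (n + 1) (heckeIncl q₁ q₂ n a)) (heckeT q₁ q₂ (n + 2) (n + 1)) :=
  commute_map_heckeT ((heckeIncl q₁ q₂ (n + 1)).comp (heckeIncl q₁ q₂ n)) (fun i h₁ h₂ => by
    rw [AlgHom.comp_apply, heckeIncl_heckeT h₂, heckeIncl_heckeT (by omega)]
    exact heckeT_comm _ _ _ (by omega)) a

/-- The conditional expectation of `T x T`, where `T` is the last generator. -/
theorem condExp_heckeT_mul_mul (x : Hecke q₁ q₂ (n + 1)) :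
    condExp q₁ q₂ z (n + 1)
        (heckeT q₁ q₂ (n + 2) (n + 1) * heckeIncl q₁ q₂ (n + 1) x * heckeT q₁ q₂ (n + 2) (n + 1)) =
      ((q₁ : R) + q₂) • x -
        ((q₁ : R) * q₂) • heckeIncl q₁ q₂ n (condExp q₁ q₂ z n x) := by
  induction x using hecke_succ_induction with
  | add x y hx hy =>
    simp only [map_add, mul_add, add_mul, hx, hy, smul_add]
    abel
  | incl a =>
    rw [← (commute_incl_incl_heckeT a).eq, mul_assoc, heckeT_mul_self, condExp_incl_mul, map_sub,
      map_smul, map_smul, condExp_heckeT _ (by omega), condExp_one, condExp_incl, map_smul,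
      mul_sub, mul_smul_comm, mul_smul_comm, mul_smul_comm, mul_one]
  | mul hn a b =>
    have hb := (isBraidSeq_heckeT q₁ q₂ (n + 2)).braid n hn (by omega)
    -- The outer generators pass `a` and `b`, and the braid relation leaves a single `T_{n+1}`,
    -- which the expectation removes.
    have e : heckeT q₁ q₂ (n + 2) (n + 1) *
        heckeIncl q₁ q₂ (n + 1) (heckeIncl q₁ q₂ n a * heckeT q₁ q₂ (n + 1) n *
          heckeIncl q₁ q₂ n b) * heckeT q₁ q₂ (n + 2) (n + 1) =
        heckeIncl q₁ q₂ (n + 1) (heckeIncl q₁ q₂ n a * heckeT q₁ q₂ (n + 1) n) *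
          (heckeT q₁ q₂ (n + 2) (n + 1) *
        heckeIncl q₁ q₂ (n + 1) (heckeT q₁ q₂ (n + 1) n * heckeIncl q₁ q₂ n b)) := by
      simp only [map_mul, heckeIncl_heckeT (show n < n + 1 by omega)]
      simp only [mul_assoc]
      rw [(commute_incl_incl_heckeT b).eq, ← mul_assoc (heckeT q₁ q₂ (n + 2) (n + 1)),
        ← (commute_incl_incl_heckeT a).eq, mul_assoc]
      congr 1
      simp only [← mul_assoc]
      rw [hb]
    rw [e, condExp_incl_mul, condExp_mul_incl, condExp_heckeT _ (by omega), one_mul,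
      condExp_mul_incl, condExp_incl_mul, condExp_heckeT _ hn, mul_one,
      mul_assoc, ← mul_assoc (heckeT q₁ q₂ (n + 1) n), heckeT_mul_self]
    simp only [map_mul, sub_mul, mul_sub, smul_mul_assoc, mul_smul_comm, one_mul, mul_assoc]

end CondExp

/-! ### The Markov trace -/

section MarkovTrace

variable {R : Type*} [CommRing R] (q₁ q₂ : Rˣ)

theorem exists_augmentation : ∃ φ : Hecke q₁ q₂ 1 →ₐ[R] R, φ 1 = 1 :=
  -- `H_1` has no generators, so the chosen sequence is immaterial.
  ⟨(exists_hecke_lift (fun _ => 0) (by omega) (by omega) (by omega)).choose, map_one _⟩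

/-- The Markov trace with parameter `z` on `H_{n+1}`, normalized by `tr(1) = 1` on `H_1`. -/
def markovTrace (z : R) : ∀ n : ℕ, Hecke q₁ q₂ (n + 1) →ₗ[R] R
  | 0 => (exists_augmentation q₁ q₂).choose.toLinearMap
  | n + 1 => (markovTrace z n).comp (condExp q₁ q₂ z (n + 1))

variable {q₁ q₂} (z : R)

theorem markovTrace_succ (n : ℕ) (x : Hecke q₁ q₂ (n + 2)) :
    markovTrace q₁ q₂ z (n + 1) x = markovTrace q₁ q₂ z n (condExp q₁ q₂ z (n + 1) x) := rfl

theorem markovTrace_zero_one : markovTrace q₁ q₂ z 0 1 = 1 :=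
  (exists_augmentation q₁ q₂).choose_spec

theorem heckeIncl_condExp_zero (x : Hecke q₁ q₂ 1) :
    heckeIncl q₁ q₂ 0 (condExp q₁ q₂ z 0 x) = z • x := by
  induction x using hecke_succ_induction with
  | add x y hx hy => rw [map_add, map_add, hx, hy, smul_add]
  | incl a => rw [condExp_incl, map_smul]
  | mul h => omega

/-- For `n ≥ 1` both sides are the previous trace of `E(x) E(y)`. On `H_1`, where no earlier trace
exists, both are `z` times the trace of `x y`. -/
theorem markovTrace_condExp_mul (n : ℕ) (x y : Hecke q₁ q₂ (n + 1)) :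
    markovTrace q₁ q₂ z n (heckeIncl q₁ q₂ n (condExp q₁ q₂ z n x) * y) =
      markovTrace q₁ q₂ z n (x * heckeIncl q₁ q₂ n (condExp q₁ q₂ z n y)) := by
  cases n with
  | zero => rw [heckeIncl_condExp_zero, heckeIncl_condExp_zero, smul_mul_assoc, mul_smul_comm]
  | succ n => rw [markovTrace_succ, markovTrace_succ, condExp_incl_mul, condExp_mul_incl]

/-- It suffices to commute past generators. The lower ones are handled by bilinearity of `E` over
the smaller algebra and induction, leaving only the last. -/
theorem isTraceFunction_markovTrace (n : ℕ) : IsTraceFunction (markovTrace q₁ q₂ z n) := by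
  induction n with
  | zero =>
    intro a b
    obtain ⟨r, rfl⟩ := exists_algebraMap_eq le_rfl a
    rw [Algebra.commutes]
  | succ n ih =>
    intro a b
    induction b using hecke_mul_induction generalizing a with
    | scalar r => rw [Algebra.commutes]
    | add x y hx hy => rw [mul_add, add_mul, map_add, map_add, hx, hy]
    | mul x y hx hy => rw [← mul_assoc, hy, ← mul_assoc, hx, mul_assoc]
    | gen i h₁ h₂ =>
      rcases Nat.lt_or_ge i (n + 1) with h | h
      · rw [← heckeIncl_heckeT h, markovTrace_succ, markovTrace_succ, condExp_incl_mul,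
          condExp_mul_incl, ih]
      · obtain rfl : i = n + 1 := by omega
        induction a using hecke_succ_induction with
        | add x y hx hy => rw [mul_add, add_mul, map_add, map_add, hx, hy]
        | incl x =>
          rw [markovTrace_succ, markovTrace_succ, condExp_incl_mul, condExp_mul_incl,
            condExp_heckeT _ (by omega), one_mul, mul_one]
        -- Applying `E` to `T y T` on one side and to `T x T` on the other, the two traces differ
        -- only in `x E(y)` against `E(x) y`, which `markovTrace_condExp_mul` equates.
        | mul _ x y =>
          have e₁ : heckeIncl q₁ q₂ (n + 1) x * heckeT q₁ q₂ (n + 2) (n + 1) *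
              heckeIncl q₁ q₂ (n + 1) y * heckeT q₁ q₂ (n + 2) (n + 1) =
              heckeIncl q₁ q₂ (n + 1) x * (heckeT q₁ q₂ (n + 2) (n + 1) *
              heckeIncl q₁ q₂ (n + 1) y * heckeT q₁ q₂ (n + 2) (n + 1)) := by
            simp only [mul_assoc]
          have e₂ : heckeT q₁ q₂ (n + 2) (n + 1) * (heckeIncl q₁ q₂ (n + 1) x *
              heckeT q₁ q₂ (n + 2) (n + 1) * heckeIncl q₁ q₂ (n + 1) y) =
              (heckeT q₁ q₂ (n + 2) (n + 1) * heckeIncl q₁ q₂ (n + 1) x *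
              heckeT q₁ q₂ (n + 2) (n + 1)) * heckeIncl q₁ q₂ (n + 1) y := by
            simp only [mul_assoc]
          rw [e₁, e₂, markovTrace_succ, markovTrace_succ, condExp_incl_mul, condExp_mul_incl,
            condExp_heckeT_mul_mul, condExp_heckeT_mul_mul, mul_sub, sub_mul, map_sub, map_sub,
            mul_smul_comm, mul_smul_comm, smul_mul_assoc, smul_mul_assoc, map_smul, map_smul,
            map_smul, markovTrace_condExp_mul]

end MarkovTrace

/-! ### Trace functions are determined by their values on the `b_λ` -/

section Cocenter

variable {R : Type*} [CommRing R] {q₁ q₂ : Rˣ}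

theorem descProd_succ_first {M : Type*} [Monoid M] (u : ℕ → M) (d k : ℕ) :
    descProd u (d + 1) k = descProd u d (k + 1) * u (k + 1) := by
  induction d with
  | zero => simp [descProd]
  | succ d ih =>
    rw [descProd, ih, descProd, mul_assoc]
    congr 2
    omega

theorem exists_heckeEmb (q₁ q₂ : Rˣ) {k N : ℕ} (h : k ≤ N) :
    ∃ φ : Hecke q₁ q₂ k →ₐ[R] Hecke q₁ q₂ N, ∀ i, 1 ≤ i → i < k →
      φ (heckeT q₁ q₂ k i) = heckeT q₁ q₂ N i :=
  exists_hecke_lift _ (fun _ _ _ h _ => heckeT_comm _ _ _ (Or.inl h))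
    (fun i h₁ h₂ => (isBraidSeq_heckeT q₁ q₂ N).braid i h₁ (by omega))
    (fun _ _ _ => heckeT_mul_self _ _ _ _)

/-- The homomorphism `H_k → H_N`, `Tᵢ ↦ Tᵢ`, for `k ≤ N`. -/
def heckeEmb (q₁ q₂ : Rˣ) {k N : ℕ} (h : k ≤ N) : Hecke q₁ q₂ k →ₐ[R] Hecke q₁ q₂ N :=
  (exists_heckeEmb q₁ q₂ h).choose

theorem heckeEmb_heckeT {k N i : ℕ} (h : k ≤ N) (h₁ : 1 ≤ i) (h₂ : i < k) :
    heckeEmb q₁ q₂ h (heckeT q₁ q₂ k i) = heckeT q₁ q₂ N i :=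
  (exists_heckeEmb q₁ q₂ h).choose_spec i h₁ h₂

theorem heckeEmb_heckeIncl {k N : ℕ} (h : k + 1 ≤ N) (x : Hecke q₁ q₂ k) :
    heckeEmb q₁ q₂ h (heckeIncl q₁ q₂ k x) = heckeEmb q₁ q₂ (Nat.le_of_succ_le h) x := by
  refine DFunLike.congr_fun (f := (heckeEmb q₁ q₂ h).comp (heckeIncl q₁ q₂ k))
    (hecke_algHom_ext fun i h₁ h₂ => ?_) x
  rw [AlgHom.comp_apply, heckeIncl_heckeT h₂, heckeEmb_heckeT _ h₁ (by omega),
    heckeEmb_heckeT _ h₁ h₂]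

theorem heckeIncl_heckeEmb {k N : ℕ} (h : k ≤ N) (x : Hecke q₁ q₂ k) :
    heckeIncl q₁ q₂ N (heckeEmb q₁ q₂ h x) = heckeEmb q₁ q₂ (Nat.le_succ_of_le h) x := by
  refine DFunLike.congr_fun (f := (heckeIncl q₁ q₂ N).comp (heckeEmb q₁ q₂ h))
    (hecke_algHom_ext fun i h₁ h₂ => ?_) x
  rw [AlgHom.comp_apply, heckeEmb_heckeT _ h₁ h₂, heckeIncl_heckeT (by omega),
    heckeEmb_heckeT _ h₁ h₂]

theorem heckeEmb_self {N : ℕ} (x : Hecke q₁ q₂ N) : heckeEmb q₁ q₂ le_rfl x = x := by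
  refine DFunLike.congr_fun (g := AlgHom.id R _) (hecke_algHom_ext fun i h₁ h₂ => ?_) x
  rw [heckeEmb_heckeT _ h₁ h₂, AlgHom.id_apply]

theorem commute_heckeEmb_descProd {k N : ℕ} (h : k ≤ N) (x : Hecke q₁ q₂ k) (d : ℕ) :
    Commute (heckeEmb q₁ q₂ h x) (descProd (heckeT q₁ q₂ N) d k) :=
  commute_map_heckeT _ (fun i h₁ h₂ => by
    rw [heckeEmb_heckeT h h₁ h₂]
    exact commute_descProd _ fun j hj _ => heckeT_comm _ _ _ (by omega)) x

theorem heckeEmb_blockProd {k N : ℕ} (h : k ≤ N) {l : List ℕ} (hl : l.sum = k) :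
    heckeEmb q₁ q₂ h (blockProd (heckeT q₁ q₂ k) 0 l) = blockProd (heckeT q₁ q₂ N) 0 l :=
  map_blockProd _ _ _ _ fun i h₁ h₂ => heckeEmb_heckeT h (by omega) (by omega)

theorem blockProd_concat_eq_mul {k d N : ℕ} (h : k + d < N) {l : List ℕ} (hl : l.sum = k) :
    blockProd (heckeT q₁ q₂ N) 0 (l ++ [d + 1]) =
      descProd (heckeT q₁ q₂ N) d k *
        heckeEmb q₁ q₂ (show k ≤ N by omega) (blockProd (heckeT q₁ q₂ k) 0 l) := by
  rw [blockProd_concat, zero_add, hl, ← (commute_heckeEmb_descProd _ _ _).eq,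
    heckeEmb_blockProd _ hl, Nat.add_sub_cancel]

/-- Dual form of the statement that the block braids span `H_N` modulo commutators. With `D_k = T_n
⋯ T_{k+1}`, one shows that `t(D_k x) = 0` for `x ∈ H_{k+1}`; the case `k = n`, where `D_n = 1`, is
the claim. -/
theorem eq_zero_of_blockProd (N : ℕ) : ∀ t : Hecke q₁ q₂ N →ₗ[R] R, IsTraceFunction t →
    (∀ l : List ℕ, (∀ m ∈ l, 1 ≤ m) → l.sum = N → t (blockProd (heckeT q₁ q₂ N) 0 l) = 0) →
    ∀ x, t x = 0 := by
  induction N using Nat.strong_induction_on with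
  | _ N ih =>
  intro t ht hb
  cases N with
  | zero =>
    intro x
    obtain ⟨r, rfl⟩ := exists_algebraMap_eq zero_le_one x
    have := hb [] (by simp) rfl
    rw [blockProd_nil] at this
    rw [Algebra.algebraMap_eq_smul_one, map_smul, this, smul_zero]
  | succ n =>
    -- `D_k` commutes with `H_k`, so `x ↦ t(D_k x)` is a trace on the smaller `H_k`. On block braids
    -- it equals `t` of the block braid with a further block of `n - k + 1` strands.
    have hA : ∀ k, ∀ hk : k < n + 1, ∀ x : Hecke q₁ q₂ k,
        t (descProd (heckeT q₁ q₂ (n + 1)) (n - k) k * heckeEmb q₁ q₂ hk.le x) = 0 := by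
      intro k hk
      refine ih k hk (t.comp ((LinearMap.mulLeft R
        (descProd (heckeT q₁ q₂ (n + 1)) (n - k) k)).comp (heckeEmb q₁ q₂ hk.le).toLinearMap))
        (fun a b => ?_) fun l hl hs => ?_
      · simp only [LinearMap.comp_apply, LinearMap.mulLeft_apply, AlgHom.toLinearMap_apply,
          map_mul]
        rw [← mul_assoc, ← (commute_heckeEmb_descProd _ a _).eq, mul_assoc, ht, mul_assoc]
      · simp only [LinearMap.comp_apply, LinearMap.mulLeft_apply, AlgHom.toLinearMap_apply]
        rw [← blockProd_concat_eq_mul (by omega) hs]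
        refine hb _ (fun m hm => ?_) ?_
        · rcases List.mem_append.1 hm with hm | hm
          · exact hl m hm
          · rw [List.mem_singleton] at hm
            omega
        · simp only [List.sum_append, hs, List.sum_singleton]
          omega
    -- For `x = a T_k b` with `a, b ∈ H_k`, one has `D_k a T_k b = a D_{k-1} b`; cyclicity turns
    -- this into `D_{k-1} (b a)`, so induction on `k` applies.
    have hB : ∀ k, ∀ hk : k + 1 ≤ n + 1, ∀ x : Hecke q₁ q₂ (k + 1),
        t (descProd (heckeT q₁ q₂ (n + 1)) (n - k) k * heckeEmb q₁ q₂ hk x) = 0 := by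
      intro k
      induction k with
      | zero =>
        intro hk x
        induction x using hecke_succ_induction with
        | add x y hx hy => rw [map_add, mul_add, map_add, hx, hy, add_zero]
        | incl a => rw [heckeEmb_heckeIncl]; exact hA _ hk a
        | mul h => omega
      | succ k ihk =>
        intro hk x
        induction x using hecke_succ_induction with
        | add x y hx hy => rw [map_add, mul_add, map_add, hx, hy, add_zero]
        | incl a => rw [heckeEmb_heckeIncl]; exact hA _ hk a
        | mul h a b =>
          have hc := commute_heckeEmb_descProd (show k + 1 ≤ n + 1 by omega) a (n - (k + 1))
          have hk' : k + 1 ≤ n + 1 := by omega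
          have e : descProd (heckeT q₁ q₂ (n + 1)) (n - (k + 1)) (k + 1) *
              heckeEmb q₁ q₂ hk (heckeIncl q₁ q₂ (k + 1) a * heckeT q₁ q₂ (k + 1 + 1) (k + 1) *
                heckeIncl q₁ q₂ (k + 1) b) =
              heckeEmb q₁ q₂ hk' a * (descProd (heckeT q₁ q₂ (n + 1)) (n - k) k *
                heckeEmb q₁ q₂ hk' b) := by
            rw [show n - k = n - (k + 1) + 1 by omega, descProd_succ_first, map_mul, map_mul,
              heckeEmb_heckeIncl, heckeEmb_heckeIncl, heckeEmb_heckeT _ h (by omega)]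
            simp only [← mul_assoc]
            rw [hc.eq]
          rw [e, ht, mul_assoc, ← map_mul (heckeEmb q₁ q₂ hk')]
          exact ihk _ _
    intro x
    have := hB n le_rfl x
    rwa [Nat.sub_self, descProd, one_mul, heckeEmb_self] at this

/-- The conjugator that reorders the blocks is a product of generators, hence a unit, and traces are
conjugation invariant. -/
theorem IsTraceFunction.blockProd_perm {N : ℕ} {t : Hecke q₁ q₂ N →ₗ[R] R}
    (ht : IsTraceFunction t) {l l' : List ℕ} (h : l.Perm l') (hl : ∀ m ∈ l, 1 ≤ m)
    (hs : l.sum = N) :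
    t (blockProd (heckeT q₁ q₂ N) 0 l) = t (blockProd (heckeT q₁ q₂ N) 0 l') := by
  obtain ⟨x, hx, hxl⟩ :=
    (isBraidSeq_heckeT q₁ q₂ N).exists_semiconjBy_of_perm h 0 (by omega) hl
  have hle : Submonoid.closure (heckeT q₁ q₂ N '' {i | 0 < i ∧ i < 0 + l.sum}) ≤
      IsUnit.submonoid (Hecke q₁ q₂ N) := by
    rw [Submonoid.closure_le]
    rintro _ ⟨i, _, rfl⟩
    exact isUnit_heckeT q₁ q₂ N i
  obtain ⟨x, rfl⟩ : IsUnit x := hle hx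
  rw [← Units.inv_mul_cancel_left x (blockProd (heckeT q₁ q₂ N) 0 l), hxl.eq, ht,
    Units.mul_inv_cancel_right]

theorem braidToHecke_sigma {n : ℕ} (i : GenIdx n) :
    braidToHecke q₁ q₂ n (sigma i) = genUnit q₁ q₂ i :=
  PresentedGroup.toGroup.of _

theorem braidToHecke_partitionBraid {n : ℕ} (p : n.Partition) :
    (braidToHecke q₁ q₂ n (partitionBraid p) : Hecke q₁ q₂ n) =
      blockProd (heckeT q₁ q₂ n) 0 (sortedParts p) := by
  change ((Units.coeHom _).comp (braidToHecke q₁ q₂ n)) _ = _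
  rw [partitionBraid, map_list_prod, List.map_pmap, blockProd]
  congr 1
  refine Eq.trans (List.pmap_congr_left _ fun i _ h _ => ?_)
    (List.pmap_eq_map (p := fun i => 1 ≤ i ∧ i < n) (fun i hi => ?_))
  · rw [MonoidHom.comp_apply, braidToHecke_sigma, heckeT_of_mem q₁ q₂ h]
    rfl
  · have := mem_blockWord _ _ hi
    rw [sum_sortedParts] at this
    omega

theorem sortedParts_pos {n : ℕ} (p : n.Partition) {m : ℕ} (hm : m ∈ sortedParts p) : 1 ≤ m :=
  p.parts_pos (Multiset.mem_sort _ |>.1 hm)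

/-- A trace function is determined by its values on the `b_λ`. -/
theorem IsTraceFunction.ext {n : ℕ} {t t' : Hecke q₁ q₂ n →ₗ[R] R} (ht : IsTraceFunction t)
    (ht' : IsTraceFunction t')
    (h : ∀ p : n.Partition, t (braidToHecke q₁ q₂ n (partitionBraid p)) =
      t' (braidToHecke q₁ q₂ n (partitionBraid p))) : t = t' := by
  have hs : IsTraceFunction (t - t') := fun a b => by
    rw [LinearMap.sub_apply, LinearMap.sub_apply, ht, ht']
  ext x
  refine sub_eq_zero.1 (eq_zero_of_blockProd n (t - t') hs (fun l hl hsum => ?_) x)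
  -- Forgetting the order of a composition gives a partition, whose sorted list is a permutation of
  -- it.
  let p : n.Partition := ⟨l, fun {m} hm => hl m hm, by simpa using hsum⟩
  have hp : l.Perm (sortedParts p) :=
    Multiset.coe_eq_coe.1 (Multiset.sort_eq (p.parts) (· ≥ ·)).symm
  rw [hs.blockProd_perm hp hl hsum, ← braidToHecke_partitionBraid, LinearMap.sub_apply, h,
    sub_self]

end Cocenter

/-! ### Normalized Markov traces -/

section Markov

variable {R : Type*} [CommRing R] {q₁ q₂ : Rˣ}

theorem heckeT_last (n : ℕ) :
    heckeT q₁ q₂ (n + 2) (n + 1) = gen q₁ q₂ (GenIdx.last n) :=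
  heckeT_val q₁ q₂ (GenIdx.last n)

theorem mul_smul_genUnit_inv {n : ℕ} (i : GenIdx n) :
    ((q₁ : R) * q₂) • (((genUnit q₁ q₂ i)⁻¹ : (Hecke q₁ q₂ n)ˣ) : Hecke q₁ q₂ n) =
      ((q₁ : R) + q₂) • 1 - gen q₁ q₂ i := by
  change ((q₁ : R) * q₂) • ((((q₁ * q₂)⁻¹ : Rˣ) : R) •
    (algebraMap R _ ((q₁ : R) + q₂) - gen q₁ q₂ i)) = _
  rw [smul_smul, ← Units.val_mul, Units.mul_inv, one_smul, Algebra.algebraMap_eq_smul_one]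

/-- From `q₁ q₂ T⁻¹ = (q₁ + q₂) - T` one gets `q₁ q₂ E(T⁻¹) = (q₁ + q₂) z - 1`, and `hz` makes this
`q₁ q₂`. -/
theorem isNormalizedMarkovTrace_markovTrace {z : R}
    (hz : ((q₁ : R) + q₂) * z = 1 + (q₁ : R) * q₂) :
    IsNormalizedMarkovTrace (markovTrace q₁ q₂ z) where
  trace := isTraceFunction_markovTrace z
  stab n b := by
    rw [markovTrace_succ, condExp_mul_incl, ← heckeT_last, condExp_heckeT _ (by omega), one_mul]
  stab_inv n b := by
    have h : condExp q₁ q₂ z (n + 1)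
        ((genUnit q₁ q₂ (GenIdx.last n))⁻¹ : (Hecke q₁ q₂ (n + 2))ˣ) = 1 := by
      have hu : IsUnit ((q₁ : R) * q₂) := (q₁ * q₂).isUnit
      refine hu.smul_left_cancel.1 ?_
      rw [← map_smul, mul_smul_genUnit_inv, map_sub, map_smul, condExp_one, ← heckeT_last,
        condExp_heckeT _ (by omega), smul_smul, hz, add_smul, one_smul, add_sub_cancel_left]
    rw [markovTrace_succ, condExp_mul_incl, h, one_mul]

/-- Comparing the two stabilizations through `q₁ q₂ T⁻¹ = (q₁ + q₂) - T` determines `(q₁ + q₂) tr(ι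
b)`; invertibility of `q₁ + q₂` then shows that an added straight strand costs a factor `z`. -/
theorem IsNormalizedMarkovTrace.incl {tr : ∀ n : ℕ, Hecke q₁ q₂ (n + 1) →ₗ[R] R}
    (h : IsNormalizedMarkovTrace tr) (hq : IsUnit ((q₁ : R) + q₂)) {z : R}
    (hz : ((q₁ : R) + q₂) * z = 1 + (q₁ : R) * q₂) (n : ℕ) (b : Hecke q₁ q₂ (n + 1)) :
    tr (n + 1) (heckeIncl q₁ q₂ (n + 1) b) = z * tr n b := by
  refine hq.mul_left_cancel ?_
  have h₁ : ((q₁ : R) * q₂) * tr n b = ((q₁ : R) * q₂) * tr (n + 1)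
      (((genUnit q₁ q₂ (GenIdx.last n))⁻¹ : (Hecke q₁ q₂ (n + 2))ˣ) *
        heckeIncl q₁ q₂ (n + 1) b) := by
    rw [← h.stab_inv]
  rw [← smul_eq_mul _ (tr (n + 1) _), ← map_smul, ← smul_mul_assoc, mul_smul_genUnit_inv, sub_mul,
    map_sub, ← h.stab, smul_mul_assoc, one_mul, map_smul, smul_eq_mul] at h₁
  linear_combination -h₁ - (tr n b) * hz

/-- Each leading factor is the last generator on its number of strands, so `d` positive
destabilizations remove them all. -/
theorem IsNormalizedMarkovTrace.descProd_mul {tr : ∀ n : ℕ, Hecke q₁ q₂ (n + 1) →ₗ[R] R}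
    (h : IsNormalizedMarkovTrace tr) (d k : ℕ) (x : Hecke q₁ q₂ (k + 1)) :
    tr (k + d) (descProd (heckeT q₁ q₂ (k + d + 1)) d k *
      heckeEmb q₁ q₂ (show k + 1 ≤ k + d + 1 by omega) x) = tr k x := by
  induction d with
  | zero =>
    rw [descProd, one_mul]
    exact congrArg (tr k) (heckeEmb_self x)
  | succ d ih =>
    rw [← ih, h.stab (k + d), map_mul (heckeIncl q₁ q₂ (k + d + 1)), heckeIncl_heckeEmb,
      ← heckeT_last, map_descProd _ _ (heckeT q₁ q₂ (k + d + 1 + 1)) _ _ fun i h₁ h₂ =>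
        heckeIncl_heckeT (by omega), ← mul_assoc]
    rfl

theorem IsNormalizedMarkovTrace.blockProd {tr : ∀ n : ℕ, Hecke q₁ q₂ (n + 1) →ₗ[R] R}
    (h : IsNormalizedMarkovTrace tr) (hq : IsUnit ((q₁ : R) + q₂)) {z : R}
    (hz : ((q₁ : R) + q₂) * z = 1 + (q₁ : R) * q₂) (l : List ℕ) :
    ∀ n : ℕ, (∀ m ∈ l, 1 ≤ m) → l.sum = n + 1 →
      tr n (blockProd (heckeT q₁ q₂ (n + 1)) 0 l) = z ^ (l.length - 1) * tr 0 1 := by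
  induction l using List.reverseRecOn with
  | nil => exact fun n _ hs => absurd hs (by simp)
  | append_singleton l m ih =>
    intro n hl hs
    have hm : 1 ≤ m := hl m (by simp)
    obtain ⟨d, rfl⟩ : ∃ d, m = d + 1 := ⟨m - 1, by omega⟩
    simp only [List.sum_append, List.sum_singleton] at hs
    obtain ⟨k, hk⟩ : ∃ k, l.sum = k := ⟨_, rfl⟩
    obtain rfl : n = k + d := by omega
    rw [blockProd_concat_eq_mul (by omega) hk]
    cases k with
    | zero =>
      have hnil : l = [] := by
        rw [List.eq_nil_iff_forall_not_mem]
        intro a ha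
        have h₁ := hl a (by simp [ha])
        have h₂ := List.le_sum_of_mem ha
        omega
      subst hnil
      have := h.descProd_mul d 0 1
      rw [map_one] at this
      rw [blockProd_nil, map_one, this]
      simp
    | succ k =>
      have hne : l ≠ [] := by
        rintro rfl
        simp at hk
      have hlen : l.length = l.length - 1 + 1 := by
        have := List.length_pos_iff.2 hne
        omega
      -- Destabilizing the last block leaves one straight strand beside the other blocks. It
      -- contributes the factor `z`, absent when the block is the only one.
      have := h.descProd_mul d (k + 1)
        (heckeIncl q₁ q₂ (k + 1) (BraidTrace.blockProd (heckeT q₁ q₂ (k + 1)) 0 l))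
      rw [heckeEmb_heckeIncl, h.incl hq hz, ih k (fun m hm => hl m (by simp [hm])) hk] at this
      rw [this, List.length_append, List.length_singleton, Nat.add_sub_cancel, hlen, pow_succ',
        Nat.add_sub_cancel, mul_assoc]

/-- The values of a normalized Markov trace on the `b_λ`. -/
theorem IsNormalizedMarkovTrace.partitionBraid {tr : ∀ n : ℕ, Hecke q₁ q₂ (n + 1) →ₗ[R] R}
    (h : IsNormalizedMarkovTrace tr) (hq : IsUnit ((q₁ : R) + q₂)) {z : R}
    (hz : ((q₁ : R) + q₂) * z = 1 + (q₁ : R) * q₂) (n : ℕ) (p : (n + 1).Partition) :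
    tr n (braidToHecke q₁ q₂ (n + 1) (partitionBraid p)) =
      z ^ (Multiset.card p.parts - 1) * tr 0 1 := by
  rw [braidToHecke_partitionBraid,
    h.blockProd hq hz _ n (fun _ hm => sortedParts_pos p hm) (sum_sortedParts p), sortedParts,
    Multiset.length_sort]

end Markov

/-! ### The link invariant -/

section Link

variable {R : Type*} [CommRing R] {q₁ q₂ : Rˣ}

theorem braidToHecke_braidIncl (n : ℕ) (b : Braid n) :
    (braidToHecke q₁ q₂ (n + 1) (braidIncl n b) : Hecke q₁ q₂ (n + 1)) =
      heckeIncl q₁ q₂ n (braidToHecke q₁ q₂ n b) := by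
  have h : (braidToHecke q₁ q₂ (n + 1)).comp (braidIncl n) =
      (Units.map (heckeIncl q₁ q₂ n : Hecke q₁ q₂ n →* Hecke q₁ q₂ (n + 1))).comp
        (braidToHecke q₁ q₂ n) := by
    refine PresentedGroup.ext fun i => Units.ext ?_
    change ((braidToHecke q₁ q₂ (n + 1) (braidIncl n (sigma i)) : (Hecke q₁ q₂ (n + 1))ˣ) :
      Hecke q₁ q₂ (n + 1)) = heckeIncl q₁ q₂ n (braidToHecke q₁ q₂ n (sigma i))
    have e : braidIncl n (sigma i) = sigma i.incl := PresentedGroup.toGroup.of _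
    rw [e, braidToHecke_sigma, braidToHecke_sigma]
    exact (heckeIncl_gen i).symm
  exact congrArg Units.val (DFunLike.congr_fun h b)

theorem IsNormalizedMarkovTrace.markovMove {tr : ∀ n : ℕ, Hecke q₁ q₂ (n + 1) →ₗ[R] R}
    (h : IsNormalizedMarkovTrace tr) {b b' : BraidInf} (hb : MarkovMove b b') :
    tr b.1 (braidToHecke q₁ q₂ (b.1 + 1) b.2) = tr b'.1 (braidToHecke q₁ q₂ (b'.1 + 1) b'.2) := by
  cases hb with
  | conj n a b =>
    simp only [map_mul, Units.val_mul]
    exact h.trace n _ _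
  | stab n b =>
    simp only [map_mul, Units.val_mul]
    rw [braidToHecke_braidIncl, braidToHecke_sigma]
    exact h.stab n _
  | stab_inv n b =>
    simp only [map_mul, map_inv, Units.val_mul]
    rw [braidToHecke_braidIncl, braidToHecke_sigma]
    exact h.stab_inv n _

/-- The link invariant of a normalized Markov trace. -/
def IsNormalizedMarkovTrace.linkInvariant {tr : ∀ n : ℕ, Hecke q₁ q₂ (n + 1) →ₗ[R] R}
    (h : IsNormalizedMarkovTrace tr) : BraidLink → R :=
  Quot.lift (fun b : BraidInf => tr b.1 (braidToHecke q₁ q₂ (b.1 + 1) b.2))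
    fun _ _ => h.markovMove

/-- The quadratic relation in the form `T + q₁ q₂ T⁻¹ = q₁ + q₂`; linearity of `t` is enough. -/
theorem skein_relation {n : ℕ} (t : Hecke q₁ q₂ n →ₗ[R] R) (a b : Braid n) (i : GenIdx n) :
    t (braidToHecke q₁ q₂ n (a * sigma i * b)) +
        (q₁ : R) * q₂ * t (braidToHecke q₁ q₂ n (a * (sigma i)⁻¹ * b)) =
      ((q₁ : R) + q₂) * t (braidToHecke q₁ q₂ n (a * b)) := by
  simp only [map_mul, map_inv, Units.val_mul, braidToHecke_sigma]
  rw [← smul_eq_mul _ (t _), ← map_smul, ← smul_mul_assoc, ← mul_smul_comm, mul_smul_genUnit_inv,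
    mul_sub, sub_mul, map_sub, mul_smul_comm, mul_one, smul_mul_assoc, map_smul, smul_eq_mul]
  exact add_sub_cancel _ _

end Link

end BraidTrace

end

theorem mainTheorem3 {R : Type*} [CommRing R] [IsDomain R] (q₁ q₂ : Rˣ)
    (hq : IsUnit ((q₁ : R) + (q₂ : R))) :
    ∃ tr : ∀ n : ℕ, BraidTrace.Hecke q₁ q₂ (n + 1) →ₗ[R] R,
      BraidTrace.IsNormalizedMarkovTrace tr ∧
      tr 0 1 = 1 ∧
      -- the values on the braids `b_λ`
      (∀ (n : ℕ) (p : (n + 1).Partition),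
        tr n (BraidTrace.braidToHecke q₁ q₂ (n + 1) (BraidTrace.partitionBraid p)) =
          ((1 + (q₁ : R) * (q₂ : R)) * ((hq.unit⁻¹ : Rˣ) : R)) ^ (Multiset.card p.parts - 1)) ∧
      -- these values determine each `tr n` among the trace functions
      (∀ (n : ℕ) (t : BraidTrace.Hecke q₁ q₂ (n + 1) →ₗ[R] R), BraidTrace.IsTraceFunction t →
        (∀ p : (n + 1).Partition,
          t (BraidTrace.braidToHecke q₁ q₂ (n + 1) (BraidTrace.partitionBraid p)) =
            ((1 + (q₁ : R) * (q₂ : R)) * ((hq.unit⁻¹ : Rˣ) : R)) ^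
              (Multiset.card p.parts - 1)) →
        t = tr n) ∧
      -- uniqueness up to a scalar
      (∀ tr' : ∀ n : ℕ, BraidTrace.Hecke q₁ q₂ (n + 1) →ₗ[R] R,
        BraidTrace.IsNormalizedMarkovTrace tr' → ∃ c : R, ∀ n, tr' n = c • tr n) ∧
      -- the HOMFLYPT polynomial
      (∃ P : BraidTrace.BraidLink → R,
        (∀ (n : ℕ) (b : BraidTrace.Braid (n + 1)),
          P (BraidTrace.closure b) = tr n (BraidTrace.braidToHecke q₁ q₂ (n + 1) b)) ∧
        P (BraidTrace.closure (1 : BraidTrace.Braid 1)) = 1 ∧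
        ∀ (n : ℕ) (a b : BraidTrace.Braid (n + 1)) (i : BraidTrace.GenIdx (n + 1)),
          P (BraidTrace.closure (a * BraidTrace.sigma i * b)) +
              (q₁ : R) * (q₂ : R) *
                P (BraidTrace.closure (a * (BraidTrace.sigma i)⁻¹ * b)) =
            ((q₁ : R) + (q₂ : R)) * P (BraidTrace.closure (a * b))) := by
  have hz : ((q₁ : R) + q₂) * ((1 + (q₁ : R) * (q₂ : R)) * ((hq.unit⁻¹ : Rˣ) : R)) =
      1 + (q₁ : R) * q₂ := by
    rw [mul_left_comm, hq.mul_val_inv, mul_one]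
  have h := BraidTrace.isNormalizedMarkovTrace_markovTrace hz
  have hv := h.partitionBraid hq hz
  simp only [BraidTrace.markovTrace_zero_one, mul_one] at hv
  refine ⟨_, h, BraidTrace.markovTrace_zero_one _, hv, fun n t ht hp => ?_, fun tr' h' => ?_,
    h.linkInvariant, fun _ _ => rfl, ?_, fun n a b i => BraidTrace.skein_relation _ a b i⟩
  · exact ht.ext (h.trace n) fun p => by rw [hp, hv]
  -- On each `b_λ` both traces are the same power of `z` times their value at `1 ∈ H_1`, so that
  -- value of `tr'` is the scalar.
  · refine ⟨tr' 0 1, fun n => (h'.trace n).ext (fun a b => ?_) fun p => ?_⟩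
    · rw [LinearMap.smul_apply, LinearMap.smul_apply, h.trace n]
    · rw [LinearMap.smul_apply, hv, h'.partitionBraid hq hz, smul_eq_mul, mul_comm]
  · change BraidTrace.markovTrace q₁ q₂ _ 0 (BraidTrace.braidToHecke q₁ q₂ 1 1) = 1
    rw [map_one, Units.val_one, BraidTrace.markovTrace_zero_one]
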